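/- Let $f=(f_1,\dots,f_m)$ with $f_j\in\mathbb R[x]=\mathbb R[x_1,\dots,x_n]$, let $d=\max_j\deg f_j$, and let $$S=\{x\in\mathbb R^n: g^S_j(x)\ge 0,\ 1\le j\le n_S\},\qquad B=\{y\in\mathbb R^m: g^B_j(y)\ge 0,\ 1\le j\le n_B\}$$ for polynomials $g^S_j\in\mathbb R[x]$, $g^B_j\in\mathbb R[y]=\mathbb R[y_1,\dots,y_m]$. Assume that $S\neq\emptyset$, that $F:=f(S)\subseteq B$, and that there are positive integers $N_S,N_B$ such that $N_S-\|x\|_2^2$ is one of the $g^S_j$ and $N_B-\|y\|_2^2$ is one of the $g^B_j$. Let $g_1,\dots,g_{n_K}\in\mathbb R[x,y]$, $n_K=n_S+n_B$, be the list of all $g^S_j(x)$ and all $g^B_j(y)$, so that they describe $S\times B$; put $g_0=1$, $r_j=\lceil\deg(g_j)/2\rceil$ and $r_{\min}=\max\{d,r_1,\dots,r_{n_K}\}$. Put $h_f(x,y)=-\sum_{j=1}^m(y_j-f_j(x))^2$ and $h(y)=\sup_{x\in S}h_f(x,y)$. For $r\ge r_{\min}$ let $$Q_r(S\times B)=\Big\{\sum_{j=0}^{n_K}s_jg_j:\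 s_j\in\mathbb R[x,y]\text{ a sum of squares of polynomials},\ \deg s_j\le 2(r-r_j)\Big\}.$$ Let $\lambda_B$ be the Lebesgue measure restricted to $B$ and $z^B_\beta=\int y^\beta\,d\lambda_B$. For a real sequence $z=(z_{\alpha\beta})_{(\alpha,\beta)\in\mathbb N^{n+m}}$ let $\ell_z(\sum p_{\alpha\beta}x^\alpha y^\beta)=\sum p_{\alpha\beta}z_{\alpha\beta}$, and for $g\in\mathbb R[x,y]$ let $M_k(g\,z)$ be the matrix with rows and columns indexed by the exponents $a\in\mathbb N^{n+m}$ of total degree at most $k$ and with $(a,b)$ entry $\ell_z\big(g\cdot(x,y)^{a+b}\big)$. Consider the programs $$p_r^*=\inf\Big\{\sum_\beta q_\beta z^B_\beta:\ q\in\mathbb R[y],\ \deg q\le 2r,\ q-h_f\in Q_r(S\times B)\Big\},$$ $$d_r^*=\sup\Big\{\ell_z(h_f):\ M_{r-r_j}(g_jz)\succeq0\ (0\le j\le n_K,\ r_0=0),\ \ \ell_z(y^\beta)=z^B_\beta\ \text{ for all }|\beta|\le 2r\Big\}.$$ Then: 1. For every $r\ge r_{\min}$, $p_r^*=d_r^*$.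 2. For every $r\ge r_{\min}$, the program defining $d^*_r$ has an optimal solution. If $S$ has nonempty interior, then for every $r\ge r_{\min}$ the program defining $p^*_r$ has an optimal solution, and for every choice of optimal solutions $q_r$ $(r\ge r_{\min})$ one has $\lim_{r\to\infty}\int|q_r-h|\,d\lambda_B=0$. 3. If $S$ has nonempty interior and the $q_r$ are such optimal solutions, then the sets $F^1_r=\{y\in B:q_r(y)\ge0\}$ satisfy $F^1_r\supseteq F$ for all $r\ge r_{\min}$ and $\lim_{r\to\infty}\mathrm{vol}(F^1_r\setminus F)=0$. -/

import Mathlib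

open MeasureTheory Filter Topology

namespace PolyImage

noncomputable section

/-- The basic semialgebraic set `{x | g j x ≥ 0 for all j}`. -/
def semialgSet {σ ι : Type*} (g : ι → MvPolynomial σ ℝ) : Set (σ → ℝ) :=
  {x | ∀ j, 0 ≤ MvPolynomial.eval x (g j)}

/-- `⌈deg g / 2⌉`. -/
def halfDegree {σ : Type*} (g : MvPolynomial σ ℝ) : ℕ := (g.totalDegree + 1) / 2

/-- One of the constraints is the ball constraint `N - ‖x‖₂² ≥ 0`, with `N` a positive integer. -/
def HasBallConstraint {σ ι : Type*} [Fintype σ] (g : ι → MvPolynomial σ ℝ) : Prop :=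
  ∃ j, ∃ N : ℕ, 0 < N ∧ g j = MvPolynomial.C (N : ℝ) - ∑ i, MvPolynomial.X i ^ 2

/-- Sums of squares of polynomials, of degree at most `2 r`. -/
def sosCone (σ : Type*) (r : ℕ) : Set (MvPolynomial σ ℝ) :=
  {s | IsSumSq s ∧ s.totalDegree ≤ 2 * r}

/-- The `r`-truncated quadratic module generated by `1` and the `g j`
(meant for `r ≥ ⌈deg g j / 2⌉` for all `j`). -/
def truncQuadModule {σ ι : Type*} [Fintype ι] (g : ι → MvPolynomial σ ℝ) (r : ℕ) :
    Set (MvPolynomial σ ℝ) :=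
  {p | ∃ s₀ ∈ sosCone σ r, ∃ s : ι → MvPolynomial σ ℝ,
    (∀ j, s j ∈ sosCone σ (r - halfDegree (g j))) ∧ p = s₀ + ∑ j, s j * g j}

/-- The linear functional `p ↦ ∑ a, p_a z_a` given by a real sequence `z` indexed by exponents. -/
def linFunctional {σ : Type*} (z : (σ →₀ ℕ) → ℝ) (p : MvPolynomial σ ℝ) : ℝ :=
  ∑ a ∈ p.support, p.coeff a * z a

/-- The localizing matrix `M_r(q z)`, with rows and columns indexed by the exponents of total
degree at most `r`. -/
def localizingMatrix {σ : Type*} (r : ℕ) (q : MvPolynomial σ ℝ) (z : (σ →₀ ℕ) → ℝ) :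
    Matrix {a : σ →₀ ℕ // a.degree ≤ r} {a : σ →₀ ℕ // a.degree ≤ r} ℝ :=
  Matrix.of fun a b => linFunctional z (q * MvPolynomial.monomial (a.1 + b.1) 1)

/-- The moment matrix `M_r(z)`. -/
def momentMatrix {σ : Type*} (r : ℕ) (z : (σ →₀ ℕ) → ℝ) :
    Matrix {a : σ →₀ ℕ // a.degree ≤ r} {a : σ →₀ ℕ // a.degree ≤ r} ℝ :=
  Matrix.of fun a b => linFunctional z (MvPolynomial.monomial (a.1 + b.1) 1)

/-- The moments of the Lebesgue measure restricted to `B`. -/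
def lebesgueMoment {m : ℕ} (B : Set (Fin m → ℝ)) (β : Fin m →₀ ℕ) : ℝ :=
  ∫ y in B, ∏ j, y j ^ β j

/-- The constraints of the product set `S × B`, as polynomials in the variables `(x, y)`. -/
def prodConstraints {n m nS nB : ℕ} (gS : Fin nS → MvPolynomial (Fin n) ℝ)
    (gB : Fin nB → MvPolynomial (Fin m) ℝ) :
    Fin nS ⊕ Fin nB → MvPolynomial (Fin n ⊕ Fin m) ℝ :=
  Sum.elim (fun j => MvPolynomial.rename Sum.inl (gS j))
    (fun j => MvPolynomial.rename Sum.inr (gB j))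

/-- The polynomial map with components `f j`. -/
def polyMap {n m : ℕ} (f : Fin m → MvPolynomial (Fin n) ℝ) (x : Fin n → ℝ) : Fin m → ℝ :=
  fun j => MvPolynomial.eval x (f j)

/-- The polynomial `h_f(x, y) = - ∑ j, (y_j - f_j(x))²`. -/
def hPoly {n m : ℕ} (f : Fin m → MvPolynomial (Fin n) ℝ) : MvPolynomial (Fin n ⊕ Fin m) ℝ :=
  -∑ j, (MvPolynomial.X (Sum.inr j) - MvPolynomial.rename Sum.inl (f j)) ^ 2

/-- `h(y) = sup_{x ∈ S} h_f(x, y)`; for nonempty `S` this is the supremum of a nonempty set of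
nonpositive reals. -/
def hSup {n m : ℕ} (S : Set (Fin n → ℝ)) (f : Fin m → MvPolynomial (Fin n) ℝ)
    (y : Fin m → ℝ) : ℝ :=
  ⨆ x : S, MvPolynomial.eval (Sum.elim x.1 y) (hPoly f)

/-- The smallest relaxation order: the maximum of the degree of `f` and of the half degrees of
all constraints. -/
def rMin {n m nS nB : ℕ} (gS : Fin nS → MvPolynomial (Fin n) ℝ)
    (gB : Fin nB → MvPolynomial (Fin m) ℝ) (f : Fin m → MvPolynomial (Fin n) ℝ) : ℕ :=
  max (Finset.univ.sup fun j => (f j).totalDegree)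
    (Finset.univ.sup fun j => halfDegree (prodConstraints gS gB j))

/-- Feasible set of the sum-of-squares program of order `r`. -/
def primalFeasible {n m nS nB : ℕ} (gS : Fin nS → MvPolynomial (Fin n) ℝ)
    (gB : Fin nB → MvPolynomial (Fin m) ℝ) (f : Fin m → MvPolynomial (Fin n) ℝ) (r : ℕ) :
    Set (MvPolynomial (Fin m) ℝ) :=
  {q | q.totalDegree ≤ 2 * r ∧
    MvPolynomial.rename Sum.inr q - hPoly f ∈ truncQuadModule (prodConstraints gS gB) r}

/-- Objective `∑ β, q_β z^B_β` of the sum-of-squares program. -/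
def primalObjective {m nB : ℕ} (gB : Fin nB → MvPolynomial (Fin m) ℝ)
    (q : MvPolynomial (Fin m) ℝ) : ℝ :=
  linFunctional (lebesgueMoment (semialgSet gB)) q

/-- Optimal value of the sum-of-squares program of order `r`, in the extended reals. -/
def primalValue {n m nS nB : ℕ} (gS : Fin nS → MvPolynomial (Fin n) ℝ)
    (gB : Fin nB → MvPolynomial (Fin m) ℝ) (f : Fin m → MvPolynomial (Fin n) ℝ) (r : ℕ) :
    EReal :=
  ⨅ q ∈ primalFeasible gS gB f r, (primalObjective gB q : EReal)

/-- `q` is an optimal solution of the sum-of-squares program of order `r`. -/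
def IsPrimalOptimal {n m nS nB : ℕ} (gS : Fin nS → MvPolynomial (Fin n) ℝ)
    (gB : Fin nB → MvPolynomial (Fin m) ℝ) (f : Fin m → MvPolynomial (Fin n) ℝ) (r : ℕ)
    (q : MvPolynomial (Fin m) ℝ) : Prop :=
  q ∈ primalFeasible gS gB f r ∧ IsMinOn (primalObjective gB) (primalFeasible gS gB f r) q

/-- Feasible set of the moment program of order `r`. -/
def dualFeasible {n m nS nB : ℕ} (gS : Fin nS → MvPolynomial (Fin n) ℝ)
    (gB : Fin nB → MvPolynomial (Fin m) ℝ) (r : ℕ) : Set ((Fin n ⊕ Fin m →₀ ℕ) → ℝ) :=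
  {z | (momentMatrix r z).PosSemidef ∧
    (∀ j, (localizingMatrix (r - halfDegree (prodConstraints gS gB j))
      (prodConstraints gS gB j) z).PosSemidef) ∧
    ∀ β : Fin m →₀ ℕ, β.degree ≤ 2 * r →
      linFunctional z (MvPolynomial.rename Sum.inr (MvPolynomial.monomial β 1)) =
        lebesgueMoment (semialgSet gB) β}

/-- Optimal value of the moment program of order `r`, in the extended reals. -/
def dualValue {n m nS nB : ℕ} (gS : Fin nS → MvPolynomial (Fin n) ℝ)
    (gB : Fin nB → MvPolynomial (Fin m) ℝ) (f : Fin m → MvPolynomial (Fin n) ℝ) (r : ℕ) :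
    EReal :=
  ⨆ z ∈ dualFeasible gS gB r, (linFunctional z (hPoly f) : EReal)

/-- `z` is an optimal solution of the moment program of order `r`. -/
def IsDualOptimal {n m nS nB : ℕ} (gS : Fin nS → MvPolynomial (Fin n) ℝ)
    (gB : Fin nB → MvPolynomial (Fin m) ℝ) (f : Fin m → MvPolynomial (Fin n) ℝ) (r : ℕ)
    (z : (Fin n ⊕ Fin m →₀ ℕ) → ℝ) : Prop :=
  z ∈ dualFeasible gS gB r ∧
    IsMaxOn (fun w => linFunctional w (hPoly f)) (dualFeasible gS gB r) z

/-- The superlevel set `{y ∈ B | q(y) ≥ 0}`. -/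
def outerSet {m : ℕ} (B : Set (Fin m → ℝ)) (q : MvPolynomial (Fin m) ℝ) : Set (Fin m → ℝ) :=
  {y ∈ B | 0 ≤ MvPolynomial.eval y q}

end

end PolyImage

/-! Zero duality gap and dual attainment come from Hahn-Banach, not from closedness of $Q_r$ or a
Slater condition. Put $N(v)=\inf\{\int_B y : y\in\mathbb R[y]_{2r},\ y-v\in Q_r\}$. The ball
constraints bound every polynomial of degree at most $2r$ by a constant modulo $Q_r$, so the infimum
is over a nonempty set. A point $x_0\in S$ gives the functional $F\mapsto\int_B F(x_0,y)\,dy$,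
nonnegative on $Q_r$, which bounds it below. Thus $N$ is sublinear, and a linear $l\le N$ with
$l(h_f)=N(h_f)$ is an optimal moment functional (`exists_dual_functional`,
`exists_dualFeasible_approx`).

If $S$ has interior and $\mathrm{vol}(B)>0$, integration over $S\times B$ is strictly positive on
$g_jp^2$ for nonzero $g_j$, $p$. Since the number of squares in a certificate can be fixed, sublevel
sets of the objective are compact in the square-factor coordinates, and the minimum is attained
(`exists_isMinOn_truncQuadModule`). If $\mathrm{vol}(B)=0$, the objective vanishes identically.

Feasible $q$ satisfy $q\ge h$ on $B$, so the $L^1$ distance to $h$ is the objective minus $\int_B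
h$. Stone-Weierstrass gives a polynomial slightly above $h$, and Putinar's theorem
(`eventually_mem_truncQuadModule`) makes it feasible for large $r$. Putinar's theorem rests on the
multiplicativity of extreme states of an archimedean quadratic module. Finally $h\ge 0$ on $F$ and
$h<0$ off $F$, so Markov's inequality turns $L^1$ convergence into volume convergence. -/

namespace PolyImage

/-! ### Conic duality by Hahn-Banach. -/

section Cone

variable {E : Type*} [AddCommGroup E] [Module ℝ E]

/-- Linear programming duality over a convex cone `K` with respect to which every vector is
dominated by an element of `Y`: the value `inf {L y | y ∈ Y, y - h ∈ K}` is attained by a dual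
functional. -/
theorem exists_dual_functional {K : Set E} (hadd : ∀ a ∈ K, ∀ b ∈ K, a + b ∈ K)
    (hsmul : ∀ t : ℝ, 0 < t → ∀ a ∈ K, t • a ∈ K) (hzero : (0 : E) ∈ K)
    (Y : Submodule ℝ E) (L : E →ₗ[ℝ] ℝ) (hL : ∀ a ∈ K, 0 ≤ L a)
    (hY : ∀ v : E, ∃ y ∈ Y, y - v ∈ K) (h : E) :
    ∃ l : E →ₗ[ℝ] ℝ, (∀ y ∈ Y, l y = L y) ∧ (∀ a ∈ K, 0 ≤ l a) ∧
      ∀ ε > 0, ∃ y ∈ Y, y - h ∈ K ∧ L y < l h + ε := by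
  classical
  set A : E → Set ℝ := fun v => {t | ∃ y ∈ Y, y - v ∈ K ∧ L y = t} with hA
  have hne : ∀ v, (A v).Nonempty := fun v => by
    obtain ⟨y, hy, hyv⟩ := hY v
    exact ⟨L y, y, hy, hyv, rfl⟩
  have hbdd : ∀ v, BddBelow (A v) := fun v => by
    refine ⟨L v, ?_⟩
    rintro t ⟨y, _, hyv, rfl⟩
    have := hL _ hyv
    rw [map_sub] at this
    linarith
  -- Any linear $l\le N$ has the required signs: testing at $\pm y$ forces $l=L$ on $Y$, and testing
  -- at $-a$ with the competitor $0\in Y$ forces $l\ge0$ on $K$.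
  set N : E → ℝ := fun v => sInf (A v) with hN
  have N_le : ∀ v y, y ∈ Y → y - v ∈ K → N v ≤ L y := fun v y hy hyv =>
    csInf_le (hbdd v) ⟨y, hy, hyv, rfl⟩
  have N_lt : ∀ v, ∀ ε > 0, ∃ y ∈ Y, y - v ∈ K ∧ L y < N v + ε := fun v ε hε => by
    obtain ⟨t, ⟨y, hy, hyv, rfl⟩, hlt⟩ := Real.lt_sInf_add_pos (hne v) hε
    exact ⟨y, hy, hyv, hlt⟩
  have N_add : ∀ v w, N (v + w) ≤ N v + N w := fun v w => by
    refine le_of_forall_pos_le_add fun ε hε => ?_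
    obtain ⟨y, hy, hyv, hlt⟩ := N_lt v (ε / 2) (half_pos hε)
    obtain ⟨y', hy', hyv', hlt'⟩ := N_lt w (ε / 2) (half_pos hε)
    have := N_le (v + w) (y + y') (Y.add_mem hy hy')
      (by convert hadd _ hyv _ hyv' using 1; abel)
    rw [map_add] at this
    linarith
  have N_hom_le : ∀ c : ℝ, 0 < c → ∀ v, N (c • v) ≤ c * N v := fun c hc v => by
    refine le_of_forall_pos_le_add fun ε hε => ?_
    obtain ⟨y, hy, hyv, hlt⟩ := N_lt v (ε / c) (div_pos hε hc)
    have := N_le (c • v) (c • y) (Y.smul_mem c hy)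
      (by rw [← smul_sub]; exact hsmul c hc _ hyv)
    rw [map_smul, smul_eq_mul] at this
    have h2 : c * L y < c * (N v + ε / c) := mul_lt_mul_of_pos_left hlt hc
    rw [mul_add, mul_div_cancel₀ _ hc.ne'] at h2
    linarith
  have N_hom : ∀ c : ℝ, 0 < c → ∀ v, N (c • v) = c * N v := fun c hc v => by
    refine le_antisymm (N_hom_le c hc v) ?_
    have := N_hom_le c⁻¹ (inv_pos.2 hc) (c • v)
    rw [inv_smul_smul₀ hc.ne'] at this
    rwa [← div_eq_inv_mul, le_div_iff₀' hc] at this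
  have N_zero : N 0 = 0 := by
    have := N_hom 2 two_pos 0
    rw [smul_zero] at this
    linarith
  -- This domination on the line through `h` lets the extension start from the value `N h` at `h`,
  -- which is what leaves no gap.
  have hdom : ∀ (c : ℝ), c * N h ≤ N (c • h) := fun c => by
    rcases lt_trichotomy c 0 with hc | rfl | hc
    · have h1 := N_hom (-c) (neg_pos.2 hc) h
      have h2 := N_add (c • h) ((-c) • h)
      rw [← add_smul, add_neg_cancel, zero_smul, N_zero] at h2
      linarith
    · simp [N_zero]
    · exact (N_hom c hc h).ge
  obtain ⟨l, hl₁, hl₂⟩ : ∃ l : E →ₗ[ℝ] ℝ, l h = N h ∧ ∀ v, l v ≤ N v := by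
    by_cases h0 : h = 0
    · obtain ⟨l, _, hl₂⟩ := exists_extension_of_le_sublinear (⊥ : E →ₗ.[ℝ] ℝ) N N_hom N_add
        (by
          rintro ⟨x, hx⟩
          have hx0 : x = 0 := (Submodule.mem_bot ℝ).1 hx
          subst hx0
          have : (⊥ : E →ₗ.[ℝ] ℝ) ⟨0, hx⟩ = 0 := LinearPMap.map_zero _
          rw [this]; exact N_zero.ge)
      exact ⟨l, by rw [h0, map_zero, N_zero], hl₂⟩
    · obtain ⟨l, hl₁, hl₂⟩ := exists_extension_of_le_sublinear
        (LinearPMap.mkSpanSingleton h (N h) h0) N N_hom N_add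
        (by
          rintro ⟨x, hx⟩
          obtain ⟨c, rfl⟩ := Submodule.mem_span_singleton.1 hx
          rw [LinearPMap.mkSpanSingleton'_apply]
          exact hdom c)
      refine ⟨l, ?_, hl₂⟩
      have := hl₁ ⟨h, Submodule.mem_span_singleton_self h⟩
      rw [LinearPMap.mkSpanSingleton_apply] at this
      exact this
  refine ⟨l, fun y hy => le_antisymm ?_ ?_, fun a ha => ?_, fun ε hε => ?_⟩
  · exact (hl₂ y).trans (N_le y y hy (by simpa using hzero))
  · have := (hl₂ (-y)).trans (N_le (-y) (-y) (Y.neg_mem hy) (by simpa using hzero))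
    rw [map_neg, map_neg] at this
    linarith
  · have := (hl₂ (-a)).trans (N_le (-a) 0 Y.zero_mem (by simpa using ha))
    rw [map_neg, map_zero] at this
    linarith
  · rw [hl₁]
    exact N_lt h ε hε

end Cone

/-! ### Archimedean quadratic modules and their states. -/

section QuadraticModule

variable {A : Type*} [CommRing A] [Algebra ℝ A]

/-- `M` is an archimedean quadratic module of the real algebra `A`. -/
structure IsArchimedeanModule (M : Set A) : Prop where
  one_mem : 1 ∈ M
  add_mem : ∀ a ∈ M, ∀ b ∈ M, a + b ∈ M
  sq_mul_mem : ∀ c : A, ∀ a ∈ M, c ^ 2 * a ∈ M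
  archimedean : ∀ a : A, ∃ N : ℝ, algebraMap ℝ A N - a ∈ M

/-- The normalized linear functionals that are nonnegative on `M`. -/
def stateSet (M : Set A) : Set (A → ℝ) :=
  {l | (∀ a b, l (a + b) = l a + l b) ∧ (∀ (t : ℝ) a, l (t • a) = t * l a) ∧ l 1 = 1 ∧
    ∀ a ∈ M, 0 ≤ l a}

namespace IsArchimedeanModule

variable {M : Set A}

theorem smul_mem (hM : IsArchimedeanModule M) {t : ℝ} (ht : 0 ≤ t) {a : A} (ha : a ∈ M) :
    t • a ∈ M := by
  have := hM.sq_mul_mem (algebraMap ℝ A (√t)) a ha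
  rwa [← map_pow, Real.sq_sqrt ht, ← Algebra.smul_def] at this

theorem zero_mem (hM : IsArchimedeanModule M) : (0 : A) ∈ M := by
  simpa using hM.smul_mem le_rfl hM.one_mem

theorem algebraMap_mem (hM : IsArchimedeanModule M) {t : ℝ} (ht : 0 ≤ t) :
    algebraMap ℝ A t ∈ M := by
  rw [Algebra.algebraMap_eq_smul_one]
  exact hM.smul_mem ht hM.one_mem

/-- An archimedean bound that can be used for `a` and `-a`, and is positive. -/
theorem exists_bound (hM : IsArchimedeanModule M) (a : A) :
    ∃ N : ℝ, 0 < N ∧ algebraMap ℝ A N - a ∈ M ∧ algebraMap ℝ A N + a ∈ M := by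
  obtain ⟨N₁, h₁⟩ := hM.archimedean a
  obtain ⟨N₂, h₂⟩ := hM.archimedean (-a)
  refine ⟨max (max N₁ N₂) 1, lt_max_of_lt_right one_pos, ?_, ?_⟩
  · have := hM.add_mem _ h₁ _
      (hM.algebraMap_mem (sub_nonneg.2 ((le_max_left N₁ N₂).trans (le_max_left _ 1))))
    rw [map_sub] at this
    convert this using 1
    ring
  · have := hM.add_mem _ h₂ _
      (hM.algebraMap_mem (sub_nonneg.2 ((le_max_right N₁ N₂).trans (le_max_left _ 1))))
    rw [map_sub] at this
    convert this using 1
    ring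

/-- The archimedean bounds confine states to a product of intervals, and all defining conditions are
closed for pointwise convergence, so Tychonoff applies without any topology on `A`. -/
theorem isCompact_stateSet (hM : IsArchimedeanModule M) : IsCompact (stateSet M) := by
  choose N hN using hM.exists_bound
  refine (isCompact_univ_pi fun a : A => isCompact_Icc (a := -N a) (b := N a)).of_isClosed_subset
    ?_ ?_
  · have h1 : IsClosed {l : A → ℝ | ∀ a b, l (a + b) = l a + l b} := by
      simp only [Set.ofPred_forall]
      exact isClosed_iInter fun a => isClosed_iInter fun b =>
        isClosed_eq (by fun_prop) (by fun_prop)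
    have h2 : IsClosed {l : A → ℝ | ∀ (t : ℝ) a, l (t • a) = t * l a} := by
      simp only [Set.ofPred_forall]
      exact isClosed_iInter fun a => isClosed_iInter fun b =>
        isClosed_eq (continuous_apply _) (continuous_const.mul (continuous_apply _))
    have h3 : IsClosed {l : A → ℝ | l 1 = 1} :=
      isClosed_eq (continuous_apply _) continuous_const
    have h4 : IsClosed {l : A → ℝ | ∀ a ∈ M, 0 ≤ l a} := by
      simp only [Set.ofPred_forall]
      exact isClosed_iInter fun a => isClosed_iInter fun _ =>
        isClosed_le continuous_const (continuous_apply _)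
    exact h1.inter (h2.inter (h3.inter h4))
  · rintro l ⟨hadd, hsmul, hone, hpos⟩ a -
    have h1 := hpos _ (hN a).2.1
    have h2 := hpos _ (hN a).2.2
    rw [hadd, Algebra.algebraMap_eq_smul_one, hsmul, hone] at h2
    rw [sub_eq_add_neg, hadd, Algebra.algebraMap_eq_smul_one, hsmul, hone,
      ← neg_one_smul ℝ a, hsmul] at h1
    exact ⟨by linarith, by linarith⟩

/-- A functional that is nonnegative on `M` is nonnegative on `(1 - c²) M` whenever
`1 - c² ∈ M`. -/
theorem nonneg_one_sub_sq_mul (hM : IsArchimedeanModule M) {l : A →ₗ[ℝ] ℝ}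
    (hpos : ∀ a ∈ M, 0 ≤ l a) {c : A} (hc : 1 - c ^ 2 ∈ M) {a : A} (ha : a ∈ M) :
    0 ≤ l ((1 - c ^ 2) * a) := by
  obtain ⟨N, hN, hNa, -⟩ := hM.exists_bound a
  -- `M` need not contain $(1-c^2)a$, so the argument goes through a sequence: `u` is convex, since
  -- its second differences are $l((c^k(1-c^2))^2a)$, and bounded above. Hence it cannot increase,
  -- and $u_1\le u_0$ is the claim.
  set u : ℕ → ℝ := fun k => l (c ^ (2 * k) * a) with hu
  set w : ℕ → ℝ := fun k => l (c ^ (2 * k)) with hw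
  have hw_anti : ∀ k, w (k + 1) ≤ w k := fun k => by
    have := hpos _ (hM.sq_mul_mem (c ^ k) _ hc)
    have e : (c ^ k) ^ 2 * (1 - c ^ 2) = c ^ (2 * k) - c ^ (2 * (k + 1)) := by ring
    rw [e, map_sub] at this
    exact sub_nonneg.1 this
  have hw_le : ∀ k, w k ≤ w 0 := fun k => antitone_nat_of_succ_le hw_anti (Nat.zero_le k)
  have hu_le : ∀ k, u k ≤ N * w 0 := fun k => by
    have := hpos _ (hM.sq_mul_mem (c ^ k) _ hNa)
    have e : (c ^ k) ^ 2 * (algebraMap ℝ A N - a) = N • c ^ (2 * k) - c ^ (2 * k) * a := by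
      rw [Algebra.smul_def]; ring
    rw [e, map_sub, map_smul, smul_eq_mul] at this
    have := mul_le_mul_of_nonneg_left (hw_le k) hN.le
    simp only [hu, hw] at *
    linarith
  have hu_conv : ∀ k, u (k + 1) - u k ≤ u (k + 2) - u (k + 1) := fun k => by
    have := hpos _ (hM.sq_mul_mem (c ^ k * (1 - c ^ 2)) _ ha)
    have e : (c ^ k * (1 - c ^ 2)) ^ 2 * a =
        c ^ (2 * k) * a - (2 : ℝ) • (c ^ (2 * (k + 1)) * a) + c ^ (2 * (k + 2)) * a := by
      rw [Algebra.smul_def, map_ofNat]; ring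
    rw [e, map_add, map_sub, map_smul, smul_eq_mul] at this
    simp only [hu]
    linarith
  have hstep : ∀ k, u 1 - u 0 ≤ u (k + 1) - u k := fun k => by
    induction k with
    | zero => exact le_rfl
    | succ k ih => exact ih.trans (hu_conv k)
  have hlin : ∀ k : ℕ, u 0 + k * (u 1 - u 0) ≤ u k := fun k => by
    induction k with
    | zero => simp
    | succ k ih => have := hstep k; push_cast; linarith
  have key : u 1 ≤ u 0 := by
    by_contra! hlt
    obtain ⟨k, hk⟩ := exists_nat_gt ((N * w 0 - u 0) / (u 1 - u 0))
    rw [div_lt_iff₀ (sub_pos.2 hlt)] at hk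
    have := hlin k
    have := hu_le k
    linarith
  have e : (1 - c ^ 2) * a = c ^ (2 * 0) * a - c ^ (2 * 1) * a := by ring
  rw [e, map_sub]
  exact sub_nonneg.2 key

/-- Extreme states of an archimedean quadratic module are multiplicative. -/
theorem map_mul_of_mem_extremePoints (hM : IsArchimedeanModule M) {l : A → ℝ}
    (hl : l ∈ (stateSet M).extremePoints ℝ) (a b : A) : l (a * b) = l a * l b := by
  obtain ⟨⟨hadd, hsmul, hone, hpos⟩, hext⟩ := hl
  let l' : A →ₗ[ℝ] ℝ := { toFun := l, map_add' := hadd, map_smul' := hsmul }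
  have hl' : ∀ a, l a = l' a := fun _ => rfl
  -- With $t=l(c^2)$, $l$ is the mean, with weights $t$ and $1-t$, of the states $l(c^2\,\cdot)/t$
  -- and $l((1-c^2)\,\cdot)/(1-t)$; extremality identifies it with the first. The bound $1/2$ keeps
  -- $t<1$, and $t=0$ is handled by $N c^2\pm c^2b\in M$.
  have small : ∀ c : A, algebraMap ℝ A (1 / 2) - c ^ 2 ∈ M →
      ∀ b, l (c ^ 2 * b) = l (c ^ 2) * l b := fun c hc b => by
    have hc1 : 1 - c ^ 2 ∈ M := by
      have h0 := hM.add_mem _ hc _ (hM.algebraMap_mem (t := 1 / 2) (by norm_num))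
      have e : algebraMap ℝ A (1 / 2) + algebraMap ℝ A (1 / 2) = 1 := by
        rw [← map_add]; norm_num
      convert h0 using 1
      rw [← e]; ring
    have ht0 : 0 ≤ l (c ^ 2) := by simpa using hpos _ (hM.sq_mul_mem c 1 hM.one_mem)
    have ht1 : l (c ^ 2) ≤ 1 / 2 := by
      have := hpos _ hc
      rw [hl', map_sub, Algebra.algebraMap_eq_smul_one, map_smul, ← hl', ← hl', hone] at this
      simpa using this
    rcases ht0.eq_or_lt with ht | ht
    · rw [← ht, zero_mul]
      obtain ⟨N, hN, h1, h2⟩ := hM.exists_bound b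
      have h1 := hpos _ (hM.sq_mul_mem c _ h1)
      have h2 := hpos _ (hM.sq_mul_mem c _ h2)
      have e1 : c ^ 2 * (algebraMap ℝ A N - b) = N • c ^ 2 - c ^ 2 * b := by
        rw [Algebra.smul_def]; ring
      have e2 : c ^ 2 * (algebraMap ℝ A N + b) = N • c ^ 2 + c ^ 2 * b := by
        rw [Algebra.smul_def]; ring
      rw [e1, hl', map_sub, map_smul, ← hl', ← hl', ← ht] at h1
      rw [e2, hl', map_add, map_smul, ← hl', ← hl', ← ht] at h2
      simp only [smul_zero] at h1 h2
      linarith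
    · set t := l (c ^ 2) with ht_def
      have ht' : 0 < 1 - t := by linarith
      let l₁ : A → ℝ := fun a => t⁻¹ * l' (c ^ 2 * a)
      let l₂ : A → ℝ := fun a => (1 - t)⁻¹ * l' ((1 - c ^ 2) * a)
      have h₁ : l₁ ∈ stateSet M := by
        refine ⟨fun a b => ?_, fun s a => ?_, ?_, fun a ha => ?_⟩
        · simp only [l₁, mul_add, map_add]
        · simp only [l₁, mul_smul_comm, map_smul, smul_eq_mul]; ring
        · simp only [l₁, mul_one, ← hl']; exact inv_mul_cancel₀ ht.ne'
        · exact mul_nonneg (inv_nonneg.2 ht.le) (hpos _ (hM.sq_mul_mem c a ha))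
      have h₂ : l₂ ∈ stateSet M := by
        refine ⟨fun a b => ?_, fun s a => ?_, ?_, fun a ha => ?_⟩
        · simp only [l₂, mul_add, map_add]
        · simp only [l₂, mul_smul_comm, map_smul, smul_eq_mul]; ring
        · simp only [l₂, mul_one]; rw [map_sub, ← hl', ← hl', hone]; exact inv_mul_cancel₀ ht'.ne'
        · exact mul_nonneg (inv_nonneg.2 ht'.le) (hM.nonneg_one_sub_sq_mul hpos hc1 ha)
      have hseg : l ∈ openSegment ℝ l₁ l₂ := by
        refine ⟨t, 1 - t, ht, ht', by ring, ?_⟩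
        funext a
        simp only [l₁, l₂, Pi.add_apply, Pi.smul_apply, smul_eq_mul]
        rw [mul_inv_cancel_left₀ ht.ne', mul_inv_cancel_left₀ ht'.ne', ← map_add, ← add_mul]
        simp [hl']
      have := congrFun (hext h₁ h₂ hseg) b
      rw [← this]
      simp only [l₁]
      rw [mul_inv_cancel_left₀ ht.ne', hl']
  have sq : ∀ c b : A, l (c ^ 2 * b) = l (c ^ 2) * l b := fun c b => by
    obtain ⟨N, hN, h1, -⟩ := hM.exists_bound (c ^ 2)
    -- This scaling turns $c^2\le N$ into $(sc)^2\le 1/2$ modulo `M`; the factor $s^2$ cancels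
    -- afterwards.
    set s : ℝ := √(1 / (2 * N)) with hs
    have hs2 : s ^ 2 = 1 / (2 * N) := Real.sq_sqrt (by positivity)
    have := small (s • c) (by
      rw [smul_pow, hs2]
      have := hM.smul_mem (t := 1 / (2 * N)) (by positivity) h1
      rw [smul_sub, Algebra.algebraMap_eq_smul_one, smul_smul] at this
      rw [Algebra.algebraMap_eq_smul_one]
      convert this using 3
      field_simp) b
    rw [smul_pow, smul_mul_assoc, hsmul, hsmul, mul_assoc] at this
    exact mul_left_cancel₀ (by rw [hs2]; positivity) this
  -- Polarization: every element is a combination of two squares, so multiplicativity against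
  -- squares suffices.
  have e1 : a * b = (1 / 4 : ℝ) • ((a + 1) ^ 2 * b - (a - 1) ^ 2 * b) := by
    have : ((a + 1) ^ 2 * b - (a - 1) ^ 2 * b) = (4 : ℝ) • (a * b) := by
      rw [Algebra.smul_def, map_ofNat]; ring
    rw [this, smul_smul]; norm_num
  have e2 : a = (1 / 4 : ℝ) • ((a + 1) ^ 2 - (a - 1) ^ 2) := by
    have : ((a + 1) ^ 2 - (a - 1) ^ 2) = (4 : ℝ) • a := by
      rw [Algebra.smul_def, map_ofNat]; ring
    rw [this, smul_smul]; norm_num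
  have e3 : l a = 1 / 4 * (l ((a + 1) ^ 2) - l ((a - 1) ^ 2)) := by
    conv_lhs => rw [e2]
    simp only [hl', map_smul, map_sub, smul_eq_mul]
  rw [e1, e3, hsmul, hl', map_sub, ← hl', ← hl', sq, sq]
  ring

/-- The representation theorem for archimedean quadratic modules: an element that is positive at
every real character nonnegative on `M` belongs to `M`. -/
theorem mem_of_forall_algHom_pos (hM : IsArchimedeanModule M) (φ₀ : A →ₐ[ℝ] ℝ)
    (hφ₀ : ∀ a ∈ M, 0 ≤ φ₀ a) {p : A}
    (hp : ∀ φ : A →ₐ[ℝ] ℝ, (∀ a ∈ M, 0 ≤ φ a) → 0 < φ p) : p ∈ M := by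
  by_contra hpM
  -- Duality with $Y=\mathbb R\cdot 1$ and $h=-p$ yields a state with $l_0(p)\le0$: otherwise some
  -- $t<0$ has $t+p\in M$, whence $p\in M$.
  obtain ⟨l₀, hl₀Y, hl₀pos, hl₀p⟩ := exists_dual_functional hM.add_mem
    (fun t ht a ha => hM.smul_mem ht.le ha) hM.zero_mem (Submodule.span ℝ {1}) φ₀.toLinearMap
    hφ₀ (fun v => by
      obtain ⟨N, hN⟩ := hM.archimedean v
      refine ⟨_, ?_, hN⟩
      rw [Algebra.algebraMap_eq_smul_one]
      exact Submodule.smul_mem _ _ (Submodule.mem_span_singleton_self 1)) (-p)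
  have hl₀1 : l₀ 1 = 1 := by
    rw [hl₀Y 1 (Submodule.mem_span_singleton_self 1)]
    exact map_one φ₀
  have hl₀le : l₀ p ≤ 0 := by
    by_contra! hlt
    obtain ⟨y, hy, hyp, hlt'⟩ := hl₀p (l₀ p) hlt
    obtain ⟨t, rfl⟩ := Submodule.mem_span_singleton.1 hy
    rw [map_neg, neg_add_cancel] at hlt'
    have ht : t < 0 := by simpa using hlt'
    refine hpM ?_
    have := hM.add_mem _ hyp _ (hM.smul_mem (neg_nonneg.2 ht.le) hM.one_mem)
    convert this using 1
    rw [neg_smul]; abel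
  have hl₀mem : ⇑l₀ ∈ stateSet M :=
    ⟨map_add l₀, fun t a => by simp, hl₀1, hl₀pos⟩
  have hcpt := hM.isCompact_stateSet
  -- The minimizers of evaluation at `p` form a compact face, so by Krein-Milman some extreme point
  -- of it is an extreme state, hence a character. Its value at `p` is at most $l_0(p)\le0$.
  set F : Set (A → ℝ) := {l ∈ stateSet M | ∀ l' ∈ stateSet M, l p ≤ l' p} with hF
  have hFne : F.Nonempty := by
    obtain ⟨l, hl, hmin⟩ := hcpt.exists_isMinOn ⟨_, hl₀mem⟩
      (f := fun l : A → ℝ => l p) (continuous_apply p).continuousOn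
    exact ⟨l, hl, fun l' hl' => hmin hl'⟩
  have hFcpt : IsCompact F := by
    refine hcpt.inter_right (t := {l | ∀ l' ∈ stateSet M, l p ≤ l' p}) ?_
    simp only [Set.ofPred_forall]
    exact isClosed_iInter fun l' => isClosed_iInter fun _ =>
      isClosed_le (continuous_apply p) continuous_const
  obtain ⟨l, hlF, hlext⟩ := hFcpt.extremePoints_nonempty hFne
  have hl : l ∈ (stateSet M).extremePoints ℝ := by
    refine ⟨hlF.1, fun l₁ h₁ l₂ h₂ hseg => ?_⟩
    have hseg' := hseg
    obtain ⟨s, t, hs, ht, hst, rfl⟩ := hseg'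
    have hmin₁ := hlF.2 l₁ h₁
    have hmin₂ := hlF.2 l₂ h₂
    simp only [Pi.add_apply, Pi.smul_apply, smul_eq_mul] at hmin₁ hmin₂
    have hs' : s = 1 - t := by linarith
    subst hs'
    have heq : l₁ p = l₂ p := by
      apply le_antisymm
      · by_contra! hlt
        nlinarith [mul_pos hs (sub_pos.2 hlt)]
      · by_contra! hlt
        nlinarith [mul_pos ht (sub_pos.2 hlt)]
    have hval : (1 - t) * l₁ p + t * l₂ p = l₁ p := by rw [heq]; ring
    refine hlext ⟨h₁, fun l' hl' => ?_⟩ ⟨h₂, fun l' hl' => ?_⟩ hseg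
    · have := hlF.2 l' hl'
      simp only [Pi.add_apply, Pi.smul_apply, smul_eq_mul] at this
      linarith
    · have := hlF.2 l' hl'
      simp only [Pi.add_apply, Pi.smul_apply, smul_eq_mul] at this
      linarith
  obtain ⟨hadd, hsmul, hone, hpos⟩ := hlF.1
  let φ : A →ₐ[ℝ] ℝ := AlgHom.ofLinearMap
    { toFun := l, map_add' := hadd, map_smul' := hsmul } hone
    (hM.map_mul_of_mem_extremePoints hl)
  have h1 : 0 < l p := hp φ hpos
  have h2 : l p ≤ l₀ p := hlF.2 _ hl₀mem
  linarith

end IsArchimedeanModule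

end QuadraticModule

end PolyImage

namespace PolyImage

noncomputable section

open MvPolynomial

/-! ### Moment sequences, linear functionals and localizing matrices. -/

section Moments

variable {σ : Type*}

/-- `linFunctional z` as a linear map. -/
def momentMap (z : (σ →₀ ℕ) → ℝ) : MvPolynomial σ ℝ →ₗ[ℝ] ℝ :=
  (basisMonomials σ ℝ).constr ℝ z

theorem momentMap_monomial (z : (σ →₀ ℕ) → ℝ) (a : σ →₀ ℕ) (c : ℝ) :
    momentMap z (monomial a c) = c * z a := by
  have h : momentMap z (monomial a 1) = z a := by
    have := (basisMonomials σ ℝ).constr_basis ℝ z a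
    rwa [coe_basisMonomials] at this
  rw [← mul_one c, ← smul_eq_mul, ← smul_monomial, map_smul, h]
  simp

theorem linFunctional_eq_momentMap (z : (σ →₀ ℕ) → ℝ) (p : MvPolynomial σ ℝ) :
    linFunctional z p = momentMap z p := by
  conv_rhs => rw [p.as_sum]
  rw [map_sum]
  exact Finset.sum_congr rfl fun a _ => (momentMap_monomial z a _).symm

theorem momentMap_of_linearMap (l : MvPolynomial σ ℝ →ₗ[ℝ] ℝ) :
    momentMap (fun a => l (monomial a 1)) = l := by
  refine (basisMonomials σ ℝ).ext fun a => ?_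
  rw [coe_basisMonomials, momentMap_monomial, one_mul]

theorem finite_exponents (σ : Type*) [Finite σ] (k : ℕ) : Finite {a : σ →₀ ℕ // a.degree ≤ k} :=
  (Finsupp.finite_of_degree_le k).to_subtype

instance exponentsFintype (σ : Type*) [Finite σ] (k : ℕ) :
    Fintype {a : σ →₀ ℕ // a.degree ≤ k} :=
  have := finite_exponents σ k
  Fintype.ofFinite _

theorem degree_le_of_mem_support {p : MvPolynomial σ ℝ} {k : ℕ} (hp : p.totalDegree ≤ k)
    {a : σ →₀ ℕ} (ha : a ∈ p.support) : a.degree ≤ k :=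
  (le_totalDegree ha).trans hp

theorem momentMatrix_eq_localizingMatrix (k : ℕ) (z : (σ →₀ ℕ) → ℝ) :
    momentMatrix k z = localizingMatrix k 1 z := by
  ext a b
  simp [momentMatrix, localizingMatrix]

variable [Finite σ]

/-- The polynomial of degree at most `k` with coefficient vector `x`. -/
def polyOfCoeff {k : ℕ} (x : {a : σ →₀ ℕ // a.degree ≤ k} → ℝ) : MvPolynomial σ ℝ :=
  ∑ a, monomial a.1 (x a)

theorem totalDegree_polyOfCoeff {k : ℕ} (x : {a : σ →₀ ℕ // a.degree ≤ k} → ℝ) :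
    (polyOfCoeff x).totalDegree ≤ k := by
  refine (totalDegree_finsetSum _ _).trans (Finset.sup_le fun a _ => ?_)
  exact (totalDegree_monomial_le _ _).trans a.2

theorem coeff_polyOfCoeff {k : ℕ} (x : {a : σ →₀ ℕ // a.degree ≤ k} → ℝ)
    (a : {a : σ →₀ ℕ // a.degree ≤ k}) : (polyOfCoeff x).coeff a.1 = x a := by
  classical
  simp only [polyOfCoeff, coeff_sum, coeff_monomial, Subtype.coe_inj]
  simp

theorem polyOfCoeff_eq_zero_iff {k : ℕ} {x : {a : σ →₀ ℕ // a.degree ≤ k} → ℝ} :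
    polyOfCoeff x = 0 ↔ x = 0 := by
  refine ⟨fun h => funext fun a => ?_, fun h => ?_⟩
  · rw [← coeff_polyOfCoeff x a, h, coeff_zero, Pi.zero_apply]
  · simp [h, polyOfCoeff]

theorem exists_polyOfCoeff_eq {k : ℕ} {p : MvPolynomial σ ℝ} (hp : p.totalDegree ≤ k) :
    ∃ x : {a : σ →₀ ℕ // a.degree ≤ k} → ℝ, polyOfCoeff x = p := by
  refine ⟨fun a => p.coeff a.1, ?_⟩
  ext b
  by_cases hb : b.degree ≤ k
  · exact coeff_polyOfCoeff _ ⟨b, hb⟩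
  · have h1 : p.coeff b = 0 := by
      by_contra h
      exact hb (degree_le_of_mem_support hp (mem_support_iff.2 h))
    rw [h1]
    by_contra h
    exact hb (degree_le_of_mem_support (totalDegree_polyOfCoeff _) (mem_support_iff.2 h))

theorem mul_polyOfCoeff_sq {k : ℕ} (q : MvPolynomial σ ℝ)
    (x : {a : σ →₀ ℕ // a.degree ≤ k} → ℝ) :
    q * polyOfCoeff x ^ 2 = ∑ a, ∑ b, (x a * x b) • (q * monomial (a.1 + b.1) 1) := by
  rw [pow_two, polyOfCoeff, Finset.sum_mul_sum, Finset.mul_sum]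
  refine Finset.sum_congr rfl fun a _ => ?_
  rw [Finset.mul_sum]
  refine Finset.sum_congr rfl fun b _ => ?_
  rw [monomial_mul, ← mul_smul_comm, smul_monomial, smul_eq_mul, mul_one]

/-- The quadratic form of the matrix at a coefficient vector is the functional applied to $q$ times
the square of the corresponding polynomial; symmetry is automatic. -/
theorem posSemidef_localizingMatrix_iff {k : ℕ} {q : MvPolynomial σ ℝ} {z : (σ →₀ ℕ) → ℝ} :
    (localizingMatrix k q z).PosSemidef ↔
      ∀ p : MvPolynomial σ ℝ, p.totalDegree ≤ k → 0 ≤ momentMap z (q * p ^ 2) := by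
  have key : ∀ x : {a : σ →₀ ℕ // a.degree ≤ k} → ℝ,
      star x ⬝ᵥ (localizingMatrix k q z).mulVec x = momentMap z (q * polyOfCoeff x ^ 2) := by
    intro x
    rw [mul_polyOfCoeff_sq]
    simp only [map_sum, map_smul, dotProduct, Matrix.mulVec, localizingMatrix, Matrix.of_apply,
      linFunctional_eq_momentMap, smul_eq_mul, Finset.mul_sum, star_trivial]
    refine Finset.sum_congr rfl fun a _ => Finset.sum_congr rfl fun b _ => ?_
    ring
  rw [Matrix.posSemidef_iff_dotProduct_mulVec]
  constructor
  · rintro ⟨-, h⟩ p hp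
    obtain ⟨x, rfl⟩ := exists_polyOfCoeff_eq hp
    rw [← key]
    exact h x
  · refine fun h => ⟨?_, fun x => ?_⟩
    · ext a b
      simp only [localizingMatrix, Matrix.conjTranspose_apply, Matrix.of_apply, star_trivial,
        add_comm]
    · rw [key]
      exact h _ (totalDegree_polyOfCoeff x)

end Moments

/-! ### Degrees and Gram factorizations of sums of squares. -/

section SumsOfSquares

variable {σ : Type*}

theorem totalDegree_sub_homogeneousComponent_lt {p : MvPolynomial σ ℝ} {D : ℕ} (hD : 0 < D)
    (hp : p.totalDegree ≤ D) : (p - homogeneousComponent D p).totalDegree < D := by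
  rw [totalDegree, Finset.sup_lt_iff (by simpa using hD)]
  intro b hb
  have hc : coeff b (p - homogeneousComponent D p) ≠ 0 := mem_support_iff.1 hb
  rw [coeff_sub, coeff_homogeneousComponent] at hc
  have hne : b.degree ≠ D := fun h => hc (by rw [if_pos h, sub_self])
  rw [if_neg hne, sub_zero] at hc
  exact lt_of_le_of_ne (degree_le_of_mem_support hp (mem_support_iff.2 hc)) hne

theorem homogeneousComponent_two_mul_sq {p : MvPolynomial σ ℝ} {D : ℕ} (hD : 0 < D)
    (hp : p.totalDegree ≤ D) :
    homogeneousComponent (2 * D) (p ^ 2) = homogeneousComponent D p ^ 2 := by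
  set t := homogeneousComponent D p with ht
  have hth : t.IsHomogeneous D := homogeneousComponent_isHomogeneous D p
  have e : p ^ 2 = t ^ 2 + (p - t) * (p + t) := by ring
  have h1 : homogeneousComponent (2 * D) ((p - t) * (p + t)) = 0 := by
    apply homogeneousComponent_eq_zero
    have h2 := totalDegree_sub_homogeneousComponent_lt hD hp
    have h3 : (p + t).totalDegree ≤ D :=
      (totalDegree_add _ _).trans (max_le hp hth.totalDegree_le)
    have := totalDegree_mul (p - t) (p + t)
    rw [← ht] at h2
    omega
  rw [e, map_add, h1, add_zero]
  have h4 : (t ^ 2).IsHomogeneous (2 * D) := by rw [mul_comm]; exact hth.pow 2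
  exact homogeneousComponent_eq_self h4

/-- Leading forms of real squares cannot cancel: a vanishing sum of their squares makes each of them
vanish at every point. A degree bound on the sum thus bounds each summand. -/
theorem totalDegree_le_of_sum_sq {ι : Type*} [Fintype ι] {p : ι → MvPolynomial σ ℝ} {k : ℕ}
    (h : (∑ i, p i ^ 2).totalDegree ≤ 2 * k) (i : ι) : (p i).totalDegree ≤ k := by
  set D := Finset.univ.sup fun i => (p i).totalDegree with hD
  have hle : ∀ i, (p i).totalDegree ≤ D := fun i =>
    Finset.le_sup (f := fun i => (p i).totalDegree) (Finset.mem_univ i)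
  refine (hle i).trans ?_
  by_contra! hkD
  have hD0 : 0 < D := (Nat.zero_le k).trans_lt hkD
  have hsum : ∑ i, homogeneousComponent D (p i) ^ 2 = 0 := by
    have : homogeneousComponent (2 * D) (∑ i, p i ^ 2) = 0 :=
      homogeneousComponent_eq_zero _ _ (by omega)
    rw [map_sum] at this
    rw [← this]
    exact Finset.sum_congr rfl fun i _ => (homogeneousComponent_two_mul_sq hD0 (hle i)).symm
  have hzero : ∀ i, homogeneousComponent D (p i) = 0 := fun i => by
    refine MvPolynomial.funext fun x => ?_
    have := congrArg (eval x) hsum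
    simp only [map_sum, map_pow, map_zero] at this
    have := (Finset.sum_eq_zero_iff_of_nonneg fun i _ => sq_nonneg _).1 this i (Finset.mem_univ i)
    simpa using this
  obtain ⟨i₀, -, hi₀⟩ := Finset.exists_mem_eq_sup Finset.univ ⟨i, Finset.mem_univ i⟩
    fun i => (p i).totalDegree
  have := totalDegree_sub_homogeneousComponent_lt hD0 (hle i₀)
  rw [hzero i₀, sub_zero] at this
  omega

theorem exists_sum_sq_of_isSumSq {R : Type*} [CommSemiring R] {s : R} (hs : IsSumSq s) :
    ∃ (N : ℕ) (p : Fin N → R), s = ∑ i, p i ^ 2 := by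
  induction hs with
  | zero => exact ⟨0, Fin.elim0, by simp⟩
  | sq_add a _ ih =>
    obtain ⟨N, p, rfl⟩ := ih
    exact ⟨N + 1, Fin.cons a p, by simp [Fin.sum_univ_succ, pow_two]⟩

theorem exists_sum_sq_of_mem_sosCone {s : MvPolynomial σ ℝ} {k : ℕ} (hs : s ∈ sosCone σ k) :
    ∃ (N : ℕ) (p : Fin N → MvPolynomial σ ℝ), (∀ i, (p i).totalDegree ≤ k) ∧
      s = ∑ i, p i ^ 2 := by
  obtain ⟨hs, hdeg⟩ := hs
  obtain ⟨N, p, rfl⟩ := exists_sum_sq_of_isSumSq hs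
  exact ⟨N, p, totalDegree_le_of_sum_sq hdeg, rfl⟩

theorem sum_sq_mem_sosCone {ι : Type*} [Fintype ι] {p : ι → MvPolynomial σ ℝ} {k : ℕ}
    (hp : ∀ i, (p i).totalDegree ≤ k) : ∑ i, p i ^ 2 ∈ sosCone σ k := by
  refine ⟨IsSumSq.sum_sq _ _, (totalDegree_finsetSum _ _).trans (Finset.sup_le fun i _ => ?_)⟩
  exact (totalDegree_pow _ _).trans (Nat.mul_le_mul_left 2 (hp i))

theorem sq_mem_sosCone {p : MvPolynomial σ ℝ} {k : ℕ} (hp : p.totalDegree ≤ k) :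
    p ^ 2 ∈ sosCone σ k := by
  simpa using sum_sq_mem_sosCone (ι := Unit) (p := fun _ => p) fun _ => hp

theorem add_mem_sosCone {s t : MvPolynomial σ ℝ} {k : ℕ} (hs : s ∈ sosCone σ k)
    (ht : t ∈ sosCone σ k) : s + t ∈ sosCone σ k :=
  ⟨hs.1.add ht.1, (totalDegree_add _ _).trans (max_le hs.2 ht.2)⟩

theorem zero_mem_sosCone (k : ℕ) : (0 : MvPolynomial σ ℝ) ∈ sosCone σ k :=
  ⟨IsSumSq.zero, by simp⟩

theorem C_mem_sosCone {t : ℝ} (ht : 0 ≤ t) (k : ℕ) : (C t : MvPolynomial σ ℝ) ∈ sosCone σ k := by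
  have := sq_mem_sosCone (p := (C (√t) : MvPolynomial σ ℝ)) (k := k) (by simp)
  rwa [← C_pow, Real.sq_sqrt ht] at this

theorem smul_mem_sosCone {t : ℝ} (ht : 0 ≤ t) {s : MvPolynomial σ ℝ} {k : ℕ}
    (hs : s ∈ sosCone σ k) : t • s ∈ sosCone σ k := by
  refine ⟨?_, (totalDegree_smul_le _ _).trans hs.2⟩
  rw [smul_eq_C_mul]
  exact (C_mem_sosCone ht 0).1.mul hs.1

theorem sosCone_mono {k l : ℕ} (h : k ≤ l) : sosCone σ k ⊆ sosCone σ l :=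
  fun _ hs => ⟨hs.1, hs.2.trans (Nat.mul_le_mul_left 2 h)⟩

open scoped MatrixOrder in
/-- A sum of squares of degree at most `2 * k` is a sum of as many squares as there are monomials
of degree at most `k`. -/
theorem exists_gram_of_mem_sosCone [Finite σ] {s : MvPolynomial σ ℝ} {k : ℕ}
    (hs : s ∈ sosCone σ k) :
    ∃ G : {a : σ →₀ ℕ // a.degree ≤ k} → {a : σ →₀ ℕ // a.degree ≤ k} → ℝ,
      s = ∑ i, polyOfCoeff (G i) ^ 2 := by
  classical
  obtain ⟨N, p, hp, rfl⟩ := exists_sum_sq_of_mem_sosCone hs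
  choose P hP using fun i => exists_polyOfCoeff_eq (hp i)
  -- The polynomial depends only on $P^{*}P$, which, being positive semidefinite, has a square
  -- factor `G`; the rows of `G` replace the `N` rows of `P`.
  obtain ⟨G, hG⟩ : ∃ G : Matrix {a : σ →₀ ℕ // a.degree ≤ k} {a : σ →₀ ℕ // a.degree ≤ k} ℝ,
      (Matrix.of P).conjTranspose * Matrix.of P = G.conjTranspose * G :=
    CStarAlgebra.nonneg_iff_eq_star_mul_self.1
      (Matrix.posSemidef_conjTranspose_mul_self (Matrix.of P)).nonneg
  refine ⟨G, ?_⟩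
  have hentry : ∀ a b, ∑ i, P i a * P i b = ∑ i, G i a * G i b := fun a b => by
    simpa [Matrix.mul_apply] using congrFun (congrFun hG a) b
  have h1 : ∀ x : {a : σ →₀ ℕ // a.degree ≤ k} → ℝ,
      polyOfCoeff x ^ 2 = ∑ a, ∑ b, (x a * x b) • (monomial (a.1 + b.1) (1 : ℝ)) := fun x => by
    simpa using mul_polyOfCoeff_sq 1 x
  simp only [← hP, h1]
  rw [Finset.sum_comm, Finset.sum_comm (s := Finset.univ) (t := Finset.univ)
    (f := fun i a => ∑ b, (G i a * G i b) • (monomial (a.1 + b.1) (1 : ℝ)))]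
  refine Finset.sum_congr rfl fun a _ => ?_
  rw [Finset.sum_comm, Finset.sum_comm (s := Finset.univ) (t := Finset.univ)
    (f := fun i b => (G i a * G i b) • (monomial (a.1 + b.1) (1 : ℝ)))]
  refine Finset.sum_congr rfl fun b _ => ?_
  rw [← Finset.sum_smul, ← Finset.sum_smul, hentry]

end SumsOfSquares

/-! ### Truncated quadratic modules. -/

section TruncatedModule

variable {σ ι : Type*}

/-- The constraints `g` together with the constraint `1`. -/
def withOne (g : ι → MvPolynomial σ ℝ) (j : Option ι) : MvPolynomial σ ℝ := j.elim 1 g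

theorem halfDegree_withOne_none (g : ι → MvPolynomial σ ℝ) : halfDegree (withOne g none) = 0 := by
  simp [halfDegree, withOne]

variable {g : ι → MvPolynomial σ ℝ} {r : ℕ}

/-- The bound on `halfDegree` is essential: the subtraction is of natural numbers and would
otherwise truncate to `0`. -/
theorem totalDegree_mul_withOne_le (hr : ∀ j, halfDegree (g j) ≤ r) {j : Option ι}
    {s : MvPolynomial σ ℝ} (hs : s.totalDegree ≤ 2 * (r - halfDegree (withOne g j))) :
    (s * withOne g j).totalDegree ≤ 2 * r := by
  have h1 : halfDegree (withOne g j) ≤ r := by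
    rcases j with _ | j
    · rw [halfDegree_withOne_none]; exact Nat.zero_le r
    · exact hr j
  have h2 : (withOne g j).totalDegree ≤ 2 * halfDegree (withOne g j) := by
    unfold halfDegree; omega
  have := totalDegree_mul s (withOne g j)
  omega

theorem eval_withOne_nonneg {w : σ → ℝ} (hw : w ∈ semialgSet g) (j : Option ι) :
    0 ≤ eval w (withOne g j) := by
  rcases j with _ | j
  · simp [withOne]
  · exact hw j

variable [Fintype ι]

theorem mem_truncQuadModule_iff {p : MvPolynomial σ ℝ} :
    p ∈ truncQuadModule g r ↔ ∃ s : Option ι → MvPolynomial σ ℝ,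
      (∀ j, s j ∈ sosCone σ (r - halfDegree (withOne g j))) ∧ p = ∑ j, s j * withOne g j := by
  constructor
  · rintro ⟨s₀, hs₀, s, hs, rfl⟩
    refine ⟨fun j => j.elim s₀ s, ?_, ?_⟩
    · rintro (_ | j)
      · rw [halfDegree_withOne_none]; exact hs₀
      · exact hs j
    · simp [Fintype.sum_option, withOne]
  · rintro ⟨s, hs, rfl⟩
    refine ⟨s none, ?_, fun j => s (some j), fun j => hs (some j), ?_⟩
    · have := hs none
      rwa [halfDegree_withOne_none] at this
    · simp [Fintype.sum_option, withOne]

theorem add_mem_truncQuadModule {p q : MvPolynomial σ ℝ} (hp : p ∈ truncQuadModule g r)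
    (hq : q ∈ truncQuadModule g r) : p + q ∈ truncQuadModule g r := by
  rw [mem_truncQuadModule_iff] at *
  obtain ⟨s, hs, rfl⟩ := hp
  obtain ⟨t, ht, rfl⟩ := hq
  refine ⟨s + t, fun j => add_mem_sosCone (hs j) (ht j), ?_⟩
  simp [add_mul, Finset.sum_add_distrib]

theorem smul_mem_truncQuadModule {t : ℝ} (ht : 0 ≤ t) {p : MvPolynomial σ ℝ}
    (hp : p ∈ truncQuadModule g r) : t • p ∈ truncQuadModule g r := by
  rw [mem_truncQuadModule_iff] at *
  obtain ⟨s, hs, rfl⟩ := hp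
  refine ⟨t • s, fun j => smul_mem_sosCone ht (hs j), ?_⟩
  simp [Finset.smul_sum]

theorem mul_mem_truncQuadModule (j : Option ι) {s : MvPolynomial σ ℝ}
    (hs : s ∈ sosCone σ (r - halfDegree (withOne g j))) :
    s * withOne g j ∈ truncQuadModule g r := by
  classical
  rw [mem_truncQuadModule_iff]
  refine ⟨Pi.single j s, fun i => ?_, ?_⟩
  · rcases eq_or_ne i j with rfl | h
    · simpa using hs
    · rw [Pi.single_eq_of_ne h]; exact zero_mem_sosCone _
  · rw [Finset.sum_eq_single j]
    · simp
    · intro i _ h; simp [Pi.single_eq_of_ne h]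
    · simp

theorem sosCone_subset_truncQuadModule : sosCone σ r ⊆ truncQuadModule g r := fun s hs => by
  have := mul_mem_truncQuadModule (g := g) (r := r) none (s := s)
    (by rwa [halfDegree_withOne_none])
  simpa [withOne] using this

theorem truncQuadModule_mono {r r' : ℕ} (h : r ≤ r') :
    truncQuadModule g r ⊆ truncQuadModule g r' := fun p hp => by
  rw [mem_truncQuadModule_iff] at *
  obtain ⟨s, hs, rfl⟩ := hp
  exact ⟨s, fun j => sosCone_mono (Nat.sub_le_sub_right h _) (hs j), rfl⟩

theorem totalDegree_le_of_mem_truncQuadModule (hr : ∀ j, halfDegree (g j) ≤ r)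
    {p : MvPolynomial σ ℝ} (hp : p ∈ truncQuadModule g r) : p.totalDegree ≤ 2 * r := by
  obtain ⟨s, hs, rfl⟩ := mem_truncQuadModule_iff.1 hp
  exact (totalDegree_finsetSum _ _).trans
    (Finset.sup_le fun j _ => totalDegree_mul_withOne_le hr (hs j).2)

theorem nonneg_of_mem_truncQuadModule {l : MvPolynomial σ ℝ →ₗ[ℝ] ℝ}
    (hl : ∀ j, ∀ p : MvPolynomial σ ℝ, p.totalDegree ≤ r - halfDegree (withOne g j) →
      0 ≤ l (withOne g j * p ^ 2)) {p : MvPolynomial σ ℝ} (hp : p ∈ truncQuadModule g r) :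
    0 ≤ l p := by
  obtain ⟨s, hs, rfl⟩ := mem_truncQuadModule_iff.1 hp
  rw [map_sum]
  refine Finset.sum_nonneg fun j _ => ?_
  obtain ⟨N, u, hu, hsu⟩ := exists_sum_sq_of_mem_sosCone (hs j)
  rw [hsu, Finset.sum_mul, map_sum]
  refine Finset.sum_nonneg fun i _ => ?_
  rw [mul_comm]
  exact hl j _ (hu i)

theorem eval_nonneg_of_mem_truncQuadModule {p : MvPolynomial σ ℝ} (hp : p ∈ truncQuadModule g r)
    {w : σ → ℝ} (hw : w ∈ semialgSet g) : 0 ≤ eval w p := by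
  refine nonneg_of_mem_truncQuadModule (l := (aeval w).toLinearMap) (fun j p _ => ?_) hp
  rw [AlgHom.toLinearMap_apply, aeval_eq_eval, map_mul, map_pow]
  exact mul_nonneg (eval_withOne_nonneg hw j) (sq_nonneg _)

/-- Every polynomial of degree at most `2 * r` is bounded by a constant modulo the truncated
quadratic module, provided each square of a variable is. -/
theorem exists_C_sub_mem_truncQuadModule
    (hg : ∀ i : σ, ∃ N : ℝ, 0 ≤ N ∧ ∀ u : MvPolynomial σ ℝ, u.totalDegree + 1 ≤ r →
      u ^ 2 * (C N - X i ^ 2) ∈ truncQuadModule g r)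
    {p : MvPolynomial σ ℝ} (hp : p.totalDegree ≤ 2 * r) :
    ∃ N : ℝ, C N - p ∈ truncQuadModule g r := by
  -- Induction on the degree through $NN_1-(bX_i)^2=N(N_1-b^2)+b^2(N-X_i^2)$.
  have hmon : ∀ k : ℕ, ∀ a : σ →₀ ℕ, a.degree = k → k ≤ r →
      ∃ N : ℝ, C N - monomial a (1 : ℝ) ^ 2 ∈ truncQuadModule g r := by
    intro k
    induction k with
    | zero =>
      intro a ha _
      rw [Finsupp.degree_eq_zero_iff] at ha
      subst ha
      refine ⟨1, ?_⟩
      have : (C 1 - monomial 0 1 ^ 2 : MvPolynomial σ ℝ) = 0 := by simp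
      rw [this]
      exact sosCone_subset_truncQuadModule (zero_mem_sosCone r)
    | succ k ih =>
      intro a ha hk
      obtain ⟨i, hi⟩ : ∃ i, a i ≠ 0 := by
        by_contra! h
        have : a = 0 := Finsupp.ext h
        rw [this] at ha
        simp at ha
      obtain ⟨b, rfl⟩ : ∃ b : σ →₀ ℕ, a = b + Finsupp.single i 1 :=
        ⟨a - Finsupp.single i 1, (tsub_add_cancel_of_le
          (Finsupp.single_le_iff.2 (Nat.one_le_iff_ne_zero.2 hi))).symm⟩
      have hb : b.degree = k := by
        rw [map_add, Finsupp.degree_single] at ha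
        omega
      obtain ⟨N₁, h₁⟩ := ih b hb (by omega)
      obtain ⟨N, hN, h⟩ := hg i
      have h2 := h (monomial b 1) (by
        have := totalDegree_monomial_le (R := ℝ) b 1
        change _ ≤ b.degree at this
        omega)
      refine ⟨N * N₁, ?_⟩
      have := add_mem_truncQuadModule (smul_mem_truncQuadModule hN h₁) h2
      convert this using 1
      have e : (monomial (b + Finsupp.single i 1) 1 : MvPolynomial σ ℝ) = monomial b 1 * X i := by
        rw [X, monomial_mul, one_mul]
      rw [e, smul_eq_C_mul, C_mul]
      ring
  -- Split the monomial into two factors $a$, $b$ of degree at most `r` and use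
  -- $\pm2ab=a^2+b^2-(a\mp b)^2$; below, `ε` carries the sign.
  have hterm : ∀ c : σ →₀ ℕ, c.degree ≤ 2 * r → ∀ t : ℝ,
      ∃ N : ℝ, C N - monomial c t ∈ truncQuadModule g r := by
    intro c hc t
    obtain ⟨a, hac, ha⟩ := Finsupp.exists_le_degree_eq c (min r c.degree) (min_le_right _ _)
    obtain ⟨b, rfl⟩ : ∃ b, c = a + b := ⟨c - a, (add_tsub_cancel_of_le hac).symm⟩
    rw [map_add] at ha hc
    have ha' : a.degree ≤ r := by omega
    have hb' : b.degree ≤ r := by omega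
    obtain ⟨N₁, h₁⟩ := hmon _ a rfl ha'
    obtain ⟨N₂, h₂⟩ := hmon _ b rfl hb'
    have hsq : ∀ ε : ℝ, (monomial a 1 + C ε * monomial b 1) ^ 2 ∈ truncQuadModule g r := fun ε => by
      refine sosCone_subset_truncQuadModule (sq_mem_sosCone ?_)
      refine (totalDegree_add _ _).trans (max_le ((totalDegree_monomial_le _ _).trans ha') ?_)
      rw [C_mul_monomial]
      exact (totalDegree_monomial_le _ _).trans hb'
    have e : (monomial (a + b) t : MvPolynomial σ ℝ) = C t * (monomial a 1 * monomial b 1) := by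
      rw [monomial_mul, C_mul_monomial, one_mul, mul_one]
    have key : ∀ ε : ℝ, ε ^ 2 = 1 → ∀ t : ℝ, 0 ≤ t →
        ∃ N : ℝ, C N - C (ε * t) * (monomial a 1 * monomial b 1) ∈ truncQuadModule g r := by
      intro ε hε t ht
      refine ⟨t / 2 * (N₁ + N₂), ?_⟩
      have := smul_mem_truncQuadModule (t := t * (1 / 2)) (by positivity) (add_mem_truncQuadModule (add_mem_truncQuadModule h₁ h₂) (hsq (-ε)))
      convert this using 1
      have hε' : (C ε : MvPolynomial σ ℝ) ^ 2 = 1 := by rw [← C_pow, hε, C_1]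
      have h2 : (C t : MvPolynomial σ ℝ) = C (t * (1 / 2)) * 2 := by
        have : (2 : MvPolynomial σ ℝ) = C 2 := by rw [map_ofNat]
        rw [this, ← C_mul]; congr 1; ring
      rw [smul_eq_C_mul, show t / 2 * (N₁ + N₂) = t * (1 / 2) * (N₁ + N₂) by ring, C_mul, C_add,
        C_mul (a := ε), h2, C_neg]
      linear_combination (-(C (t * (1 / 2)) * monomial b (1 : ℝ) ^ 2)) * hε'
    rw [e]
    rcases le_total 0 t with ht | ht
    · simpa using key 1 (by norm_num) t ht
    · simpa using key (-1) (by norm_num) (-t) (by linarith)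
  have hsum : ∀ T : Finset (σ →₀ ℕ), (∀ c ∈ T, c.degree ≤ 2 * r) →
      ∃ N : ℝ, C N - ∑ c ∈ T, monomial c (p.coeff c) ∈ truncQuadModule g r := by
    classical
    intro T
    induction T using Finset.induction_on with
    | empty =>
      exact fun _ => ⟨0, by simpa using sosCone_subset_truncQuadModule (zero_mem_sosCone r)⟩
    | insert c T hcT ih =>
      intro h
      obtain ⟨N₁, h₁⟩ := ih fun c hc => h c (Finset.mem_insert_of_mem hc)
      obtain ⟨N₂, h₂⟩ := hterm c (h c (Finset.mem_insert_self c T)) (p.coeff c)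
      refine ⟨N₂ + N₁, ?_⟩
      have := add_mem_truncQuadModule h₂ h₁
      rw [Finset.sum_insert hcT, C_add]
      convert this using 1
      ring
  obtain ⟨N, hN⟩ := hsum p.support fun c hc => degree_le_of_mem_support hp hc
  rw [← p.as_sum] at hN
  exact ⟨N, hN⟩

end TruncatedModule

end

end PolyImage

namespace PolyImage

noncomputable section

open MvPolynomial

/-! ### Zero sets of polynomials are null. -/

section ZeroSet

/-- Fubini and induction: viewed as a univariate polynomial with polynomial coefficients, `p` has
finitely many constant roots, and every other slice is a nonzero polynomial in fewer variables. -/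
theorem volume_zeroSet_fin {n : ℕ} {p : MvPolynomial (Fin n) ℝ} (hp : p ≠ 0) :
    volume {x : Fin n → ℝ | eval x p = 0} = 0 := by
  induction n with
  | zero =>
    have : {x : Fin 0 → ℝ | eval x p = 0} = ∅ := by
      refine Set.eq_empty_of_forall_notMem fun x hx => hp ?_
      refine MvPolynomial.funext fun y => ?_
      rw [Subsingleton.elim y x, map_zero]
      exact hx
    rw [this, measure_empty]
  | succ n ih =>
    set P := finSuccEquiv ℝ n p with hP
    have hP0 : P ≠ 0 := by simpa [hP] using hp
    have heval : ∀ (t : ℝ) (x : Fin n → ℝ),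
        eval (Fin.cons t x : Fin (n + 1) → ℝ) p = eval x (P.eval (C t)) := fun t x => by
      rw [eval_eq_eval_mv_eval', Polynomial.eval_map]
      have := Polynomial.eval₂_at_apply (p := P) (eval x) (C t)
      rwa [eval_C] at this
    have hmeas : MeasurableSet {x : Fin (n + 1) → ℝ | eval x p = 0} :=
      (isClosed_eq (continuous_eval p) continuous_const).measurableSet
    have hpres := (volume_preserving_piFinSuccAbove (fun _ : Fin (n + 1) => ℝ) 0).symm
    rw [← hpres.measure_preimage_equiv, Measure.volume_eq_prod,
      Measure.measure_prod_null (hpres.measurable hmeas)]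
    have hfin : {t : ℝ | P.eval (C t) = 0}.Finite := by
      have : {t : ℝ | P.eval (C t) = 0} ⊆ C ⁻¹' {q : MvPolynomial (Fin n) ℝ | P.IsRoot q} :=
        fun t ht => ht
      exact ((Polynomial.finite_setOfPred_isRoot hP0).preimage
        (C_injective (Fin n) ℝ).injOn).subset this
    have hae : ∀ᵐ t : ℝ, t ∉ {t : ℝ | P.eval (C t) = 0} :=
      measure_eq_zero_iff_ae_notMem.1 (hfin.measure_zero volume)
    filter_upwards [hae] with t ht
    have := ih (p := P.eval (C t)) ht
    rw [Pi.zero_apply, ← this]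
    congr 1
    ext x
    have hcons : (MeasurableEquiv.piFinSuccAbove (fun _ : Fin (n + 1) => ℝ) 0).symm (t, x) =
        Fin.cons t x := by
      change Fin.insertNth (α := fun _ => ℝ) 0 t x = _
      exact Fin.insertNth_zero' t x
    simp only [Set.mem_preimage, Set.mem_ofPred_eq, ← heval, hcons]

/-- The zero set of a nonzero real polynomial is a null set. -/
theorem volume_zeroSet {σ : Type*} [Fintype σ] {p : MvPolynomial σ ℝ} (hp : p ≠ 0) :
    volume {x : σ → ℝ | eval x p = 0} = 0 := by
  set e := Fintype.equivFin σ
  have hp' : rename e p ≠ 0 := fun h => hp (rename_injective e e.injective (by simpa using h))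
  have hpres := volume_measurePreserving_piCongrLeft (fun _ : σ => ℝ) e.symm
  rw [← hpres.measure_preimage_equiv, ← volume_zeroSet_fin hp']
  congr 1
  ext x
  simp only [Set.mem_preimage, Set.mem_ofPred_eq, eval_rename]
  have : (MeasurableEquiv.piCongrLeft (fun _ : σ => ℝ) e.symm) x = x ∘ e := by
    funext i
    exact (Equiv.piCongrLeft_apply _ _ _ _).trans (by simp)
  rw [this]

end ZeroSet

/-! ### Integration over compact semialgebraic sets. -/

section Integral

variable {σ ι : Type*}

theorem isClosed_semialgSet (g : ι → MvPolynomial σ ℝ) : IsClosed (semialgSet g) := by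
  have : semialgSet g = ⋂ j, {x | 0 ≤ eval x (g j)} := by
    ext x
    simp [semialgSet]
  rw [this]
  exact isClosed_iInter fun j => isClosed_le continuous_const (continuous_eval (g j))

variable [Fintype σ]

theorem isCompact_semialgSet {g : ι → MvPolynomial σ ℝ} (hg : HasBallConstraint g) :
    IsCompact (semialgSet g) := by
  obtain ⟨j, N, -, hj⟩ := hg
  -- The box of radius $N+1$ avoids square roots: $x_i^2\le N\le(N+1)^2$.
  refine (isCompact_univ_pi fun _ : σ =>
    isCompact_Icc (a := -(N + 1 : ℝ)) (b := N + 1)).of_isClosed_subset (isClosed_semialgSet g) fun x hx i _ => ?_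
  have h1 := hx j
  rw [hj] at h1
  simp only [map_sub, eval_C, map_sum, map_pow, eval_X] at h1
  have h2 : x i ^ 2 ≤ ∑ i, x i ^ 2 :=
    Finset.single_le_sum (f := fun i => x i ^ 2) (fun i _ => sq_nonneg _) (Finset.mem_univ i)
  have hN : (0 : ℝ) ≤ N := N.cast_nonneg
  exact abs_le.1 (abs_le_of_sq_le_sq (by nlinarith) (by linarith))

theorem integrableOn_eval {K : Set (σ → ℝ)} (hK : IsCompact K) (p : MvPolynomial σ ℝ) :
    IntegrableOn (fun x => eval x p) K :=
  (continuous_eval p).continuousOn.integrableOn_compact hK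

/-- Integration of polynomials over a compact set. -/
def integralFunctional {K : Set (σ → ℝ)} (hK : IsCompact K) : MvPolynomial σ ℝ →ₗ[ℝ] ℝ where
  toFun p := ∫ x in K, eval x p
  map_add' p q := by
    simp only [map_add]
    exact integral_add (integrableOn_eval hK p) (integrableOn_eval hK q)
  map_smul' t p := by
    simp only [smul_eval, RingHom.id_apply, smul_eq_mul]
    exact integral_const_mul t _

theorem integralFunctional_nonneg {K : Set (σ → ℝ)} (hK : IsCompact K) {p : MvPolynomial σ ℝ}
    (hp : ∀ x ∈ K, 0 ≤ eval x p) : 0 ≤ integralFunctional hK p :=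
  setIntegral_nonneg hK.measurableSet hp

/-- A zero integral would make `p` vanish almost everywhere on `K`, inside a null zero set. This
strictness gives the coercivity behind primal attainment. -/
theorem integralFunctional_pos {K : Set (σ → ℝ)} (hK : IsCompact K) (hvol : volume K ≠ 0)
    {p : MvPolynomial σ ℝ} (hp : ∀ x ∈ K, 0 ≤ eval x p) (hp0 : p ≠ 0) :
    0 < integralFunctional hK p := by
  refine (integralFunctional_nonneg hK hp).lt_of_ne fun h => hvol ?_
  have h0 : (fun x => eval x p) =ᵐ[volume.restrict K] 0 :=
    (setIntegral_eq_zero_iff_of_nonneg_ae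
      ((ae_restrict_iff' hK.measurableSet).2 (ae_of_all _ hp)) (integrableOn_eval hK p)).1 h.symm
  have h1 : ∀ᵐ x : σ → ℝ, x ∈ K → eval x p = 0 :=
    (ae_restrict_iff' hK.measurableSet).1 h0
  have h2 : ∀ᵐ x : σ → ℝ, x ∉ {x : σ → ℝ | eval x p = 0} :=
    measure_eq_zero_iff_ae_notMem.1 (volume_zeroSet hp0)
  rw [measure_eq_zero_iff_ae_notMem]
  filter_upwards [h1, h2] with x hx1 hx2 hxK
  exact hx2 (hx1 hxK)

end Integral

/-! ### Putinar's Positivstellensatz. -/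

section Positivstellensatz

variable {σ ι : Type*} [Fintype ι] {g : ι → MvPolynomial σ ℝ}

/-- Putinar's Positivstellensatz, with an explicit form of the archimedean condition. -/
theorem eventually_mem_truncQuadModule
    (hg : ∀ r, (∀ j, halfDegree (g j) ≤ r) → ∀ i : σ, ∃ N : ℝ, 0 ≤ N ∧
      ∀ u : MvPolynomial σ ℝ, u.totalDegree + 1 ≤ r →
        u ^ 2 * (C N - X i ^ 2) ∈ truncQuadModule g r)
    (hne : (semialgSet g).Nonempty) {p : MvPolynomial σ ℝ}
    (hp : ∀ w ∈ semialgSet g, 0 < eval w p) :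
    ∃ r₀, ∀ r, r₀ ≤ r → p ∈ truncQuadModule g r := by
  set R := Finset.univ.sup fun j => halfDegree (g j) with hR
  have hRle : ∀ j, halfDegree (g j) ≤ R := fun j =>
    Finset.le_sup (f := fun j => halfDegree (g j)) (Finset.mem_univ j)
  -- The union over `r` is a full quadratic module. Requiring `R ≤ r` rules out truncated
  -- subtraction, so that multiplying by $c^2$ costs exactly $\deg c$ in the order.
  set M : Set (MvPolynomial σ ℝ) := {p | ∃ r, R ≤ r ∧ p ∈ truncQuadModule g r} with hMdef
  have hM : IsArchimedeanModule M := by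
    refine ⟨⟨R, le_rfl, ?_⟩, ?_, ?_, ?_⟩
    · exact sosCone_subset_truncQuadModule (by simpa using C_mem_sosCone zero_le_one R)
    · rintro a ⟨r, hr, ha⟩ b ⟨r', hr', hb⟩
      exact ⟨max r r', hr.trans (le_max_left _ _), add_mem_truncQuadModule
        (truncQuadModule_mono (le_max_left _ _) ha) (truncQuadModule_mono (le_max_right _ _) hb)⟩
    · rintro c a ⟨r, hr, ha⟩
      refine ⟨r + c.totalDegree, by omega, ?_⟩
      rw [mem_truncQuadModule_iff] at ha ⊢
      obtain ⟨s, hs, rfl⟩ := ha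
      refine ⟨fun j => c ^ 2 * s j, fun j => ⟨?_, ?_⟩, ?_⟩
      · exact (IsSquare.sq c).isSumSq.mul (hs j).1
      · have h1 := (hs j).2
        have h2 := totalDegree_mul (c ^ 2) (s j)
        have h3 := totalDegree_pow c 2
        have h4 : halfDegree (withOne g j) ≤ r := by
          rcases j with _ | j
          · rw [halfDegree_withOne_none]; exact Nat.zero_le r
          · exact (hRle j).trans hr
        change (c ^ 2 * s j).totalDegree ≤ _
        omega
      · simp only [Finset.mul_sum, mul_assoc]
    · intro a
      have hr : ∀ j, halfDegree (g j) ≤ R + a.totalDegree := fun j => (hRle j).trans (by omega)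
      obtain ⟨N, hN⟩ := exists_C_sub_mem_truncQuadModule (hg _ hr) (p := a) (by omega)
      exact ⟨N, _, Nat.le_add_right _ _, hN⟩
  obtain ⟨w₀, hw₀⟩ := hne
  have hpM : p ∈ M := by
    refine hM.mem_of_forall_algHom_pos (aeval w₀) ?_ fun φ hφ => ?_
    · rintro a ⟨r, -, ha⟩
      rw [aeval_eq_eval]
      exact eval_nonneg_of_mem_truncQuadModule ha hw₀
    -- Characters of the polynomial ring are point evaluations; as each $g_j$ lies in `M`, the point
    -- lies in the semialgebraic set.
    · have hφeq : ∀ q, φ q = eval (fun i => φ (X i)) q := fun q => by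
        conv_lhs => rw [aeval_unique φ]
        rw [aeval_eq_eval]
        rfl
      rw [hφeq]
      refine hp _ fun j => ?_
      rw [← hφeq]
      refine hφ _ ⟨R, le_rfl, ?_⟩
      have := mul_mem_truncQuadModule (g := g) (r := R) (some j) (s := 1)
        (by simpa using C_mem_sosCone zero_le_one _)
      simpa [withOne] using this
  obtain ⟨r₀, -, h⟩ := hpM
  exact ⟨r₀, fun r hr => truncQuadModule_mono hr h⟩

end Positivstellensatz

/-! ### Attainment of the minimum by coercivity. -/

section Attainment

variable {σ ι : Type*} [Finite σ]

theorem continuous_map_mul_polyOfCoeff_sq {k : ℕ} (q : MvPolynomial σ ℝ)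
    (l : MvPolynomial σ ℝ →ₗ[ℝ] ℝ) :
    Continuous fun x : {a : σ →₀ ℕ // a.degree ≤ k} → ℝ => l (q * polyOfCoeff x ^ 2) := by
  simp only [mul_polyOfCoeff_sq, map_sum, map_smul, smul_eq_mul]
  fun_prop

/-- The constant is the minimum of a positive definite quadratic form on the unit sphere;
homogeneity does the rest. -/
theorem exists_coercive_bound {q : MvPolynomial σ ℝ} {l : MvPolynomial σ ℝ →ₗ[ℝ] ℝ}
    (hl : ∀ p : MvPolynomial σ ℝ, p ≠ 0 → 0 < l (q * p ^ 2)) (k : ℕ) :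
    ∃ c : ℝ, 0 < c ∧ ∀ x : {a : σ →₀ ℕ // a.degree ≤ k} → ℝ,
      c * ‖x‖ ^ 2 ≤ l (q * polyOfCoeff x ^ 2) := by
  have hne : Nonempty {a : σ →₀ ℕ // a.degree ≤ k} := ⟨⟨0, by simp⟩⟩
  obtain ⟨u, hu, hmin⟩ := (isCompact_sphere (0 : {a : σ →₀ ℕ // a.degree ≤ k} → ℝ) 1).exists_isMinOn
    (NormedSpace.sphere_nonempty.2 zero_le_one)
    (continuous_map_mul_polyOfCoeff_sq (k := k) q l).continuousOn
  have hu1 : ‖u‖ = 1 := by simpa using hu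
  refine ⟨_, hl (polyOfCoeff u) fun h => ?_, fun x => ?_⟩
  · rw [polyOfCoeff_eq_zero_iff.1 h, norm_zero] at hu1
    exact zero_ne_one hu1
  · rcases eq_or_ne x 0 with rfl | hx
    · have : polyOfCoeff (0 : {a : σ →₀ ℕ // a.degree ≤ k} → ℝ) = 0 :=
        polyOfCoeff_eq_zero_iff.2 rfl
      simp [this]
    · have hx' : ‖x‖ ≠ 0 := norm_ne_zero_iff.2 hx
      have hmem : ‖x‖⁻¹ • x ∈ Metric.sphere (0 : {a : σ →₀ ℕ // a.degree ≤ k} → ℝ) 1 := by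
        simp [norm_smul, hx']
      have h1 := hmin hmem
      have h2 : polyOfCoeff (‖x‖⁻¹ • x) = ‖x‖⁻¹ • polyOfCoeff x := by
        simp only [polyOfCoeff, Finset.smul_sum, smul_monomial, Pi.smul_apply]
      simp only [Set.mem_ofPred_eq, h2, smul_pow, mul_smul_comm, map_smul, smul_eq_mul] at h1
      rw [inv_pow, ← div_eq_inv_mul, le_div_iff₀ (by positivity)] at h1
      exact h1

/-- If `l` is strictly positive, then a linear program over the truncated quadratic module with
objective `l` attains its minimum. -/
theorem exists_isMinOn_truncQuadModule [Fintype ι] {g : ι → MvPolynomial σ ℝ} {r : ℕ}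
    {l : MvPolynomial σ ℝ →ₗ[ℝ] ℝ}
    (hl : ∀ j, withOne g j ≠ 0 → ∀ p : MvPolynomial σ ℝ, p ≠ 0 → 0 < l (withOne g j * p ^ 2))
    (h : MvPolynomial σ ℝ) (T : MvPolynomial σ ℝ →ₗ[ℝ] MvPolynomial σ ℝ)
    (hne : ∃ F, T F = 0 ∧ F - h ∈ truncQuadModule g r) :
    ∃ F, T F = 0 ∧ F - h ∈ truncQuadModule g r ∧
      ∀ F', T F' = 0 → F' - h ∈ truncQuadModule g r → l F ≤ l F' := by
  classical
  let I : Option ι → Type _ := fun j => {a : σ →₀ ℕ // a.degree ≤ r - halfDegree (withOne g j)}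
  -- Candidates are parametrized by square factors of fixed size. This makes the parameter space
  -- finite-dimensional, and compactness there replaces closedness of the module.
  let Ψ : (∀ j, I j → I j → ℝ) → MvPolynomial σ ℝ := fun G =>
    h + ∑ j, ∑ i, withOne g j * polyOfCoeff (G j i) ^ 2
  have hΨcont : ∀ m : MvPolynomial σ ℝ →ₗ[ℝ] ℝ, Continuous fun G => m (Ψ G) := fun m => by
    simp only [Ψ, map_add, map_sum]
    refine continuous_const.add (continuous_finsetSum _ fun j _ =>
      continuous_finsetSum _ fun i _ => ?_)
    exact (continuous_map_mul_polyOfCoeff_sq (withOne g j) m).comp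
      ((continuous_apply i).comp (continuous_apply j))
  have hΨmem : ∀ G, Ψ G - h ∈ truncQuadModule g r := fun G => by
    rw [mem_truncQuadModule_iff]
    refine ⟨fun j => ∑ i, polyOfCoeff (G j i) ^ 2,
      fun j => sum_sq_mem_sosCone fun i => totalDegree_polyOfCoeff _, ?_⟩
    simp only [Ψ, add_sub_cancel_left]
    refine Finset.sum_congr rfl fun j _ => ?_
    rw [mul_comm, Finset.mul_sum]
  -- A zero constraint contributes nothing, so its block is normalized to `0`; otherwise that block
  -- would be unbounded on sublevel sets.
  have hΨsurj : ∀ F, F - h ∈ truncQuadModule g r →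
      ∃ G, Ψ G = F ∧ ∀ j, withOne g j = 0 → G j = 0 := fun F hF => by
    obtain ⟨s, hs, hFs⟩ := mem_truncQuadModule_iff.1 hF
    choose G hG using fun j => exists_gram_of_mem_sosCone (hs j)
    refine ⟨fun j => if withOne g j = 0 then 0 else G j, ?_, fun j hj => if_pos hj⟩
    simp only [Ψ]
    rw [sub_eq_iff_eq_add'.1 hFs]
    congr 1
    refine Finset.sum_congr rfl fun j _ => ?_
    by_cases hj : withOne g j = 0
    · simp [hj]
    · rw [if_neg hj, hG j, Finset.sum_mul]
      exact Finset.sum_congr rfl fun i _ => mul_comm _ _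
  obtain ⟨F₀, hTF₀, hF₀⟩ := hne
  obtain ⟨G₀, hG₀, hG₀'⟩ := hΨsurj F₀ hF₀
  have hcoer : ∀ j, ∃ c : ℝ, 0 < c ∧ (withOne g j ≠ 0 → ∀ x : I j → ℝ,
      c * ‖x‖ ^ 2 ≤ l (withOne g j * polyOfCoeff x ^ 2)) := fun j => by
    by_cases hj : withOne g j = 0
    · exact ⟨1, one_pos, fun h => absurd hj h⟩
    · obtain ⟨c, hc, h⟩ := exists_coercive_bound (hl j hj) (r - halfDegree (withOne g j))
      exact ⟨c, hc, fun _ => h⟩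
  choose c hc hcl using hcoer
  let T₀ : Set (∀ j, I j → I j → ℝ) :=
    {G | T (Ψ G) = 0 ∧ (∀ j, withOne g j = 0 → G j = 0) ∧ l (Ψ G) ≤ l F₀}
  have hclosed : IsClosed T₀ := by
    have h1 : IsClosed {G | T (Ψ G) = 0} := by
      have : {G | T (Ψ G) = 0} = ⋂ a, {G | (lcoeff ℝ a ∘ₗ T) (Ψ G) = 0} := by
        ext G
        simp [MvPolynomial.ext_iff]
      rw [this]
      exact isClosed_iInter fun a => isClosed_eq (hΨcont _) continuous_const
    have h2 : IsClosed {G : ∀ j, I j → I j → ℝ | ∀ j, withOne g j = 0 → G j = 0} := by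
      simp only [Set.ofPred_forall]
      exact isClosed_iInter fun j => isClosed_iInter fun _ =>
        isClosed_eq (continuous_apply j) continuous_const
    exact h1.inter (h2.inter (isClosed_le (hΨcont l) continuous_const))
  have hnonneg : ∀ j (x : I j → ℝ), 0 ≤ l (withOne g j * polyOfCoeff x ^ 2) := fun j x => by
    by_cases hj : withOne g j = 0
    · simp [hj]
    · exact (by have := hc j; positivity : 0 ≤ c j * ‖x‖ ^ 2).trans (hcl j hj x)
  set D := l F₀ - l h with hD
  have hbound : ∀ G ∈ T₀, ∀ j i, ‖G j i‖ ≤ |D| / c j + 1 := by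
    rintro G ⟨-, hG0, hGl⟩ j i
    have hpos : 0 ≤ |D| / c j := div_nonneg (abs_nonneg _) (hc j).le
    by_cases hj : withOne g j = 0
    · rw [hG0 j hj, Pi.zero_apply, norm_zero]
      linarith
    · have h1 : l (withOne g j * polyOfCoeff (G j i) ^ 2) ≤ D := by
        have h2 : l (withOne g j * polyOfCoeff (G j i) ^ 2) ≤
            ∑ i, l (withOne g j * polyOfCoeff (G j i) ^ 2) :=
          Finset.single_le_sum (f := fun i => l (withOne g j * polyOfCoeff (G j i) ^ 2))
            (fun i _ => hnonneg j _) (Finset.mem_univ i)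
        have h3 : ∑ i, l (withOne g j * polyOfCoeff (G j i) ^ 2) ≤
            ∑ j, ∑ i, l (withOne g j * polyOfCoeff (G j i) ^ 2) :=
          Finset.single_le_sum (f := fun j => ∑ i, l (withOne g j * polyOfCoeff (G j i) ^ 2))
            (fun j _ => Finset.sum_nonneg fun i _ => hnonneg j _) (Finset.mem_univ j)
        simp only [Ψ, map_add, map_sum] at hGl
        linarith
      have h4 := (hcl j hj (G j i)).trans (h1.trans (le_abs_self D))
      rw [mul_comm, ← le_div_iff₀ (hc j)] at h4
      -- From $\|x\|^2\le|D|/c$ one gets $\|x\|\le|D|/c+1$, since $2\|x\|\le\|x\|^2+1$.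
      nlinarith [sq_nonneg (‖G j i‖ - 1)]
  have hcompact : IsCompact T₀ := by
    refine (isCompact_univ_pi fun j => isCompact_univ_pi fun _ : I j =>
      isCompact_closedBall (0 : I j → ℝ) (|D| / c j + 1)).of_isClosed_subset hclosed ?_
    intro G hG j _ i _
    simpa using hbound G hG j i
  obtain ⟨G, hG, hmin⟩ := hcompact.exists_isMinOn ⟨G₀, by rw [hG₀]; exact hTF₀, hG₀', by rw [hG₀]⟩
    (hΨcont l).continuousOn
  refine ⟨Ψ G, hG.1, hΨmem G, fun F hTF hF => ?_⟩
  obtain ⟨G', rfl, hG'⟩ := hΨsurj F hF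
  rcases le_total (l (Ψ G')) (l F₀) with hle | hle
  · exact hmin ⟨hTF, hG', hle⟩
  · exact hG.2.2.trans hle

end Attainment

end

end PolyImage

namespace PolyImage

noncomputable section

open MvPolynomial

/-! ### Consequences of the ball constraint. -/

section Ball

variable {σ τ ι : Type*} [Fintype τ]

/-- Write $N-X_i^2=(N-\sum_kX_k^2)+\sum_{k\ne i}X_k^2$. The map `e` selects one block of variables,
since $S$ and $B$ have separate balls. -/
theorem sq_mul_ball_mem_truncQuadModule [Fintype ι] {g : ι → MvPolynomial σ ℝ} {j : ι} {N : ℝ}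
    {e : τ → σ} (hj : g j = C N - ∑ k, X (e k) ^ 2) (i : τ) {r : ℕ} {u : MvPolynomial σ ℝ}
    (hu : u.totalDegree + 1 ≤ r) : u ^ 2 * (C N - X (e i) ^ 2) ∈ truncQuadModule g r := by
  classical
  have hdeg : halfDegree (withOne g (some j)) ≤ 1 := by
    have : (withOne g (some j)).totalDegree ≤ 2 := by
      change (g j).totalDegree ≤ 2
      rw [hj]
      refine (totalDegree_sub _ _).trans (max_le (by simp) ?_)
      refine (totalDegree_finsetSum _ _).trans (Finset.sup_le fun k _ => ?_)
      exact (totalDegree_pow _ _).trans (by simp)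
    unfold halfDegree
    omega
  have h1 := mul_mem_truncQuadModule (g := g) (r := r) (some j) (s := u ^ 2)
    (sq_mem_sosCone (by omega))
  have h2 : ∑ k : {k : τ // k ≠ i}, (u * X (e k)) ^ 2 ∈ truncQuadModule g r :=
    sosCone_subset_truncQuadModule (sum_sq_mem_sosCone fun k => (totalDegree_mul _ _).trans
      (by simpa using hu))
  have h3 : ∑ k, (u * X (e k)) ^ 2 =
      (u * X (e i)) ^ 2 + ∑ k : {k : τ // k ≠ i}, (u * X (e k)) ^ 2 :=
    Fintype.sum_eq_add_sum_subtype_ne _ i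
  have h4 : u ^ 2 * ∑ k, X (e k) ^ 2 = ∑ k, (u * X (e k)) ^ 2 := by
    rw [Finset.mul_sum]
    exact Finset.sum_congr rfl fun k _ => (mul_pow _ _ _).symm
  convert add_mem_truncQuadModule h1 h2 using 1
  change _ = u ^ 2 * g j + _
  rw [hj]
  linear_combination h4 + h3

/-- The values at $0$ and at the all-ones point differ by the number of variables summed, so the
polynomial is not constant. -/
theorem one_le_halfDegree_ball [Nonempty τ] (N : ℝ) (e : τ → σ) :
    1 ≤ halfDegree (C N - ∑ k, X (e k) ^ 2 : MvPolynomial σ ℝ) := by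
  have : (C N - ∑ k, X (e k) ^ 2 : MvPolynomial σ ℝ).totalDegree ≠ 0 := fun h => by
    rw [totalDegree_eq_zero_iff_eq_C] at h
    have h0 := congrArg (eval 0) h
    have h1 := congrArg (eval 1) h
    rw [eval_C] at h0 h1
    rw [← h1] at h0
    have hcard : (0 : ℝ) < Fintype.card τ := Nat.cast_pos.2 Fintype.card_pos
    simp at h0
    linarith
  unfold halfDegree
  omega

end Ball

/-! ### Product constraints, feasibility and substitution. -/

variable {n m nS nB : ℕ} {gS : Fin nS → MvPolynomial (Fin n) ℝ}
  {gB : Fin nB → MvPolynomial (Fin m) ℝ} {f : Fin m → MvPolynomial (Fin n) ℝ}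

theorem mem_semialgSet_prodConstraints_iff {w : Fin n ⊕ Fin m → ℝ} :
    w ∈ semialgSet (prodConstraints gS gB) ↔
      w ∘ Sum.inl ∈ semialgSet gS ∧ w ∘ Sum.inr ∈ semialgSet gB := by
  simp [semialgSet, prodConstraints, eval_rename]

theorem exists_sq_mul_ball_mem (hballS : HasBallConstraint gS) (hballB : HasBallConstraint gB)
    (r : ℕ) (i : Fin n ⊕ Fin m) :
    ∃ N : ℝ, 0 ≤ N ∧ ∀ u : MvPolynomial (Fin n ⊕ Fin m) ℝ, u.totalDegree + 1 ≤ r →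
      u ^ 2 * (C N - X i ^ 2) ∈ truncQuadModule (prodConstraints gS gB) r := by
  obtain ⟨j, N, -, hj⟩ := hballS
  obtain ⟨j', N', -, hj'⟩ := hballB
  rcases i with i | i
  · refine ⟨N, N.cast_nonneg, fun u hu =>
      sq_mul_ball_mem_truncQuadModule (j := Sum.inl j) (e := Sum.inl) ?_ i hu⟩
    simp [prodConstraints, hj]
  · refine ⟨N', N'.cast_nonneg, fun u hu =>
      sq_mul_ball_mem_truncQuadModule (j := Sum.inr j') (e := Sum.inr) ?_ i hu⟩
    simp [prodConstraints, hj']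

theorem halfDegree_le_of_rMin_le {r : ℕ} (hr : rMin gS gB f ≤ r) (j : Fin nS ⊕ Fin nB) :
    halfDegree (prodConstraints gS gB j) ≤ r :=
  (Finset.le_sup (f := fun j => halfDegree (prodConstraints gS gB j)) (Finset.mem_univ j)).trans
    ((le_max_right _ _).trans hr)

/-- This is where `rMin` enters: $f_j$ has degree at most $r$ by definition, and $y_j$ does because
the ball constraint of $B$ forces $r\ge1$ once $m>0$. Hence $q=0$ is always feasible. -/
theorem neg_hPoly_mem_sosCone (hballB : HasBallConstraint gB) {r : ℕ}
    (hr : rMin gS gB f ≤ r) : -hPoly f ∈ sosCone (Fin n ⊕ Fin m) r := by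
  rw [hPoly, neg_neg]
  refine sum_sq_mem_sosCone fun j => (totalDegree_sub _ _).trans (max_le ?_ ?_)
  · obtain ⟨j', N', -, hj'⟩ := hballB
    have : Nonempty (Fin m) := ⟨j⟩
    have h1 := one_le_halfDegree_ball (N' : ℝ) (Sum.inr : Fin m → Fin n ⊕ Fin m)
    have h2 := halfDegree_le_of_rMin_le hr (Sum.inr j')
    have h3 : prodConstraints gS gB (Sum.inr j') =
        C (N' : ℝ) - ∑ k, X (Sum.inr k) ^ 2 := by simp [prodConstraints, hj']
    rw [h3] at h2
    rw [totalDegree_X]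
    exact h1.trans h2
  · refine (totalDegree_rename_le _ _).trans ?_
    exact (Finset.le_sup (f := fun j => (f j).totalDegree) (Finset.mem_univ j)).trans
      ((le_max_left _ _).trans hr)

theorem zero_mem_primalFeasible (hballB : HasBallConstraint gB) {r : ℕ}
    (hr : rMin gS gB f ≤ r) : (0 : MvPolynomial (Fin m) ℝ) ∈ primalFeasible gS gB f r := by
  refine ⟨by simp, ?_⟩
  rw [map_zero, zero_sub]
  exact sosCone_subset_truncQuadModule (neg_hPoly_mem_sosCone hballB hr)

/-- Substitution of the point `x` for the first group of variables. -/
def substLeft (x : Fin n → ℝ) : MvPolynomial (Fin n ⊕ Fin m) ℝ →ₐ[ℝ] MvPolynomial (Fin m) ℝ :=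
  aeval (Sum.elim (fun i => C (x i)) X)

theorem eval_substLeft (x : Fin n → ℝ) (y : Fin m → ℝ) (F : MvPolynomial (Fin n ⊕ Fin m) ℝ) :
    eval y (substLeft x F) = eval (Sum.elim x y) F := by
  have : (aeval y).comp (substLeft x) =
      (aeval (Sum.elim x y) : MvPolynomial (Fin n ⊕ Fin m) ℝ →ₐ[ℝ] ℝ) := by
    refine algHom_ext fun i => ?_
    rcases i with i | i <;> simp [substLeft]
  have := DFunLike.congr_fun this F
  simpa [aeval_eq_eval] using this

theorem substLeft_rename (x : Fin n → ℝ) (q : MvPolynomial (Fin m) ℝ) :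
    substLeft x (rename Sum.inr q) = q := by
  rw [substLeft, aeval_rename]
  exact aeval_X_left_apply q

theorem totalDegree_rename_inr (q : MvPolynomial (Fin m) ℝ) :
    (rename (Sum.inr : Fin m → Fin n ⊕ Fin m) q).totalDegree = q.totalDegree := by
  refine le_antisymm (totalDegree_rename_le _ _) ?_
  refine Finset.sup_le fun a ha => ?_
  have hmem : a.mapDomain (Sum.inr : Fin m → Fin n ⊕ Fin m) ∈
      (rename (Sum.inr : Fin m → Fin n ⊕ Fin m) q).support := by
    rw [mem_support_iff, coeff_rename_mapDomain _ Sum.inr_injective]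
    exact mem_support_iff.1 ha
  have h1 := le_totalDegree hmem
  change (a.mapDomain (Sum.inr : Fin m → Fin n ⊕ Fin m)).degree ≤ _ at h1
  rw [Finsupp.degree_mapDomain] at h1
  exact h1

theorem lebesgueMoment_eq {B : Set (Fin m → ℝ)} (hB : IsCompact B) (β : Fin m →₀ ℕ) :
    lebesgueMoment B β = integralFunctional hB (monomial β 1) := by
  simp only [lebesgueMoment, integralFunctional, LinearMap.coe_mk, AddHom.coe_mk, eval_monomial,
    one_mul]
  congr 1
  funext y
  exact (Finsupp.prod_fintype _ _ (by simp)).symm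

theorem primalObjective_eq (hB : IsCompact (semialgSet gB)) (q : MvPolynomial (Fin m) ℝ) :
    primalObjective gB q = integralFunctional hB q := by
  have : lebesgueMoment (semialgSet gB) = fun β => integralFunctional hB (monomial β 1) :=
    funext (lebesgueMoment_eq hB)
  rw [primalObjective, linFunctional_eq_momentMap, this, momentMap_of_linearMap]

/-! ### Weak and strong duality. -/

section Duality

theorem le_primalObjective {r : ℕ} (hB : IsCompact (semialgSet gB))
    {z : (Fin n ⊕ Fin m →₀ ℕ) → ℝ}
    (hz : z ∈ dualFeasible gS gB r) {q : MvPolynomial (Fin m) ℝ}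
    (hq : q ∈ primalFeasible gS gB f r) :
    linFunctional z (hPoly f) ≤ primalObjective gB q := by
  obtain ⟨hz₀, hzj, hzm⟩ := hz
  obtain ⟨hdeg, hmem⟩ := hq
  have h1 : 0 ≤ momentMap z (rename Sum.inr q - hPoly f) := by
    refine nonneg_of_mem_truncQuadModule (fun j p hp => ?_) hmem
    rcases j with _ | j
    · rw [momentMatrix_eq_localizingMatrix] at hz₀
      refine posSemidef_localizingMatrix_iff.1 hz₀ p ?_
      rwa [halfDegree_withOne_none] at hp
    · exact posSemidef_localizingMatrix_iff.1 (hzj j) p hp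
  have h2 : momentMap z (rename Sum.inr q) = primalObjective gB q := by
    have hmon : ∀ β ∈ q.support, ∀ c : ℝ, momentMap z (rename Sum.inr (monomial β c)) =
        integralFunctional hB (monomial β c) := fun β hβ c => by
      have h3 := hzm β (degree_le_of_mem_support hdeg hβ)
      rw [linFunctional_eq_momentMap, lebesgueMoment_eq hB] at h3
      have h4 : (monomial β c : MvPolynomial (Fin m) ℝ) = c • monomial β 1 := by
        rw [smul_monomial, smul_eq_mul, mul_one]
      rw [h4, map_smul, map_smul, map_smul, h3]
    rw [primalObjective_eq hB, q.as_sum, map_sum, map_sum, map_sum]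
    exact Finset.sum_congr rfl fun β hβ => hmon β hβ _
  rw [map_sub, h2] at h1
  rw [linFunctional_eq_momentMap]
  linarith

/-- Conic duality among polynomials of degree at most $2r$, with $Y$ those in `y` alone. Integration
over the slice $\{x_0\}\times B$ is the positive functional, so neither an interior nor positive
volume of $B$ is needed. -/
theorem exists_dualFeasible_approx (hS : (semialgSet gS).Nonempty) (hballS : HasBallConstraint gS)
    (hballB : HasBallConstraint gB) {r : ℕ} (hr : rMin gS gB f ≤ r) :
    ∃ z ∈ dualFeasible gS gB r, ∀ ε > 0, ∃ q ∈ primalFeasible gS gB f r,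
      primalObjective gB q < linFunctional z (hPoly f) + ε := by
  obtain ⟨x₀, hx₀⟩ := hS
  have hB := isCompact_semialgSet hballB
  have hhalf := halfDegree_le_of_rMin_le hr
  set g := prodConstraints gS gB with hg
  let V := restrictTotalDegree (Fin n ⊕ Fin m) ℝ (2 * r)
  let K : Set V := {v | v.1 ∈ truncQuadModule g r}
  let Y : Submodule ℝ V := ((restrictTotalDegree (Fin m) ℝ (2 * r)).map
    (rename (Sum.inr : Fin m → Fin n ⊕ Fin m)).toLinearMap).comap V.subtype
  let L : MvPolynomial (Fin n ⊕ Fin m) ℝ →ₗ[ℝ] ℝ :=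
    integralFunctional hB ∘ₗ (substLeft x₀).toLinearMap
  have hLren : ∀ q, L (rename Sum.inr q) = integralFunctional hB q := fun q => by
    simp [L, substLeft_rename]
  have hLpos : ∀ F ∈ truncQuadModule g r, 0 ≤ L F := fun F hF => by
    refine integralFunctional_nonneg hB fun y hy => ?_
    rw [AlgHom.toLinearMap_apply, eval_substLeft]
    exact eval_nonneg_of_mem_truncQuadModule hF
      (mem_semialgSet_prodConstraints_iff.2 ⟨hx₀, hy⟩)
  have hhdeg : hPoly f ∈ V := by
    rw [mem_restrictTotalDegree, ← totalDegree_neg]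
    exact (neg_hPoly_mem_sosCone hballB hr).2
  obtain ⟨l, hlY, hlK, hlh⟩ := exists_dual_functional (K := K)
    (fun a ha b hb => add_mem_truncQuadModule ha hb)
    (fun t ht a ha => smul_mem_truncQuadModule ht.le ha)
    (sosCone_subset_truncQuadModule (zero_mem_sosCone r)) Y (L ∘ₗ V.subtype)
    (fun a ha => hLpos _ ha) (fun v => by
      obtain ⟨N, hN⟩ := exists_C_sub_mem_truncQuadModule (g := g)
        (exists_sq_mul_ball_mem hballS hballB r) ((mem_restrictTotalDegree _ _ _).1 v.2)
      refine ⟨⟨C N, by rw [mem_restrictTotalDegree]; simp⟩, ⟨C N, ?_, ?_⟩, hN⟩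
      · rw [SetLike.mem_coe, mem_restrictTotalDegree]; simp
      · simp) ⟨hPoly f, hhdeg⟩
  -- Values on degrees above $2r$ are arbitrary: no constraint of order `r` sees them.
  obtain ⟨l', hl'⟩ := LinearMap.exists_extend l
  have hl'l : ∀ v : V, l' v.1 = l v := fun v => by rw [← hl']; rfl
  have hl'K : ∀ F ∈ truncQuadModule g r, 0 ≤ l' F := fun F hF => by
    have hFV : F ∈ V := (mem_restrictTotalDegree _ _ _).2
      (totalDegree_le_of_mem_truncQuadModule hhalf hF)
    have := hlK ⟨F, hFV⟩ hF
    rwa [← hl'l] at this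
  have hl'pos : ∀ (j : Option (Fin nS ⊕ Fin nB)) (p : MvPolynomial (Fin n ⊕ Fin m) ℝ),
      p.totalDegree ≤ r - halfDegree (withOne g j) → 0 ≤ l' (withOne g j * p ^ 2) :=
    fun j p hp => by
      rw [mul_comm]
      exact hl'K _ (mul_mem_truncQuadModule j (sq_mem_sosCone hp))
  refine ⟨fun a => l' (monomial a 1), ⟨?_, fun j => ?_, fun β hβ => ?_⟩, fun ε hε => ?_⟩
  · rw [momentMatrix_eq_localizingMatrix, posSemidef_localizingMatrix_iff,
      momentMap_of_linearMap]
    intro p hp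
    exact hl'pos none p (by rwa [halfDegree_withOne_none])
  · rw [posSemidef_localizingMatrix_iff, momentMap_of_linearMap]
    exact fun p hp => hl'pos (some j) p hp
  · rw [linFunctional_eq_momentMap, momentMap_of_linearMap, lebesgueMoment_eq hB, ← hLren]
    have hβdeg : (monomial β (1 : ℝ)).totalDegree ≤ 2 * r :=
      (totalDegree_monomial_le _ _).trans hβ
    have hV : rename Sum.inr (monomial β (1 : ℝ)) ∈ V :=
      (mem_restrictTotalDegree _ _ _).2 ((totalDegree_rename_le _ _).trans hβdeg)
    have := hlY ⟨_, hV⟩ ⟨monomial β 1, (mem_restrictTotalDegree _ _ _).2 hβdeg, rfl⟩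
    rw [← hl'l] at this
    exact this
  · obtain ⟨y, ⟨q, hq, hqy⟩, hyh, hlt⟩ := hlh ε hε
    have hqy' : rename Sum.inr q = y.1 := hqy
    refine ⟨q, ⟨(mem_restrictTotalDegree _ _ _).1 hq, ?_⟩, ?_⟩
    · rw [hqy']
      exact hyh
    · rw [linFunctional_eq_momentMap, momentMap_of_linearMap, primalObjective_eq hB, ← hLren,
        hqy', hl'l ⟨hPoly f, hhdeg⟩]
      exact hlt

/-- Strong duality, with an optimal solution of the moment program. -/
theorem primalValue_eq_dualValue (hS : (semialgSet gS).Nonempty) (hballS : HasBallConstraint gS)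
    (hballB : HasBallConstraint gB) {r : ℕ} (hr : rMin gS gB f ≤ r) :
    primalValue gS gB f r = dualValue gS gB f r ∧ ∃ z, IsDualOptimal gS gB f r z := by
  have hB := isCompact_semialgSet hballB
  obtain ⟨z, hz, happrox⟩ := exists_dualFeasible_approx hS hballS hballB hr
  refine ⟨le_antisymm ?_ ?_, z, hz, fun w hw => ?_⟩
  · refine le_trans ?_ (le_iSup₂ (f := fun z _ => ((linFunctional z (hPoly f) : ℝ) : EReal)) z hz)
    by_contra! hlt
    obtain ⟨t, ht₁, ht₂⟩ := EReal.lt_iff_exists_real_btwn.1 hlt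
    rw [EReal.coe_lt_coe_iff] at ht₁
    obtain ⟨q, hq, hlt'⟩ := happrox _ (sub_pos.2 ht₁)
    rw [add_sub_cancel] at hlt'
    have h1 : primalValue gS gB f r ≤ (primalObjective gB q : EReal) := iInf₂_le q hq
    exact absurd (ht₂.trans_le h1) (not_lt.2 (EReal.coe_le_coe_iff.2 hlt'.le))
  · exact iSup₂_le fun w hw => le_iInf₂ fun q hq =>
      EReal.coe_le_coe_iff.2 (le_primalObjective hB hw hq)
  · change linFunctional w (hPoly f) ≤ linFunctional z (hPoly f)
    refine le_of_forall_pos_le_add fun ε hε => ?_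
    obtain ⟨q, hq, hlt⟩ := happrox ε hε
    exact (le_primalObjective hB hw hq).trans hlt.le

end Duality

/-! ### Optimal solutions of the sum-of-squares program. -/

section PrimalAttainment

theorem isCompact_semialgSet_prodConstraints (hS : IsCompact (semialgSet gS))
    (hB : IsCompact (semialgSet gB)) : IsCompact (semialgSet (prodConstraints gS gB)) := by
  have hcont : Continuous fun p : (Fin n → ℝ) × (Fin m → ℝ) =>
      (Sum.elim p.1 p.2 : Fin n ⊕ Fin m → ℝ) := by
    refine continuous_pi fun i => ?_
    rcases i with i | i <;> simp only [Sum.elim_inl, Sum.elim_inr] <;> fun_prop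
  refine ((hS.prod hB).image hcont).of_isClosed_subset (isClosed_semialgSet _) fun w hw => ?_
  have := mem_semialgSet_prodConstraints_iff.1 hw
  exact ⟨(w ∘ Sum.inl, w ∘ Sum.inr), this, Sum.elim_comp_inl_inr w⟩

theorem semialgSet_prodConstraints_eq_preimage :
    semialgSet (prodConstraints gS gB) =
      MeasurableEquiv.sumPiEquivProdPi (fun _ : Fin n ⊕ Fin m => ℝ) ⁻¹'
        (semialgSet gS ×ˢ semialgSet gB) := by
  ext w
  rw [mem_semialgSet_prodConstraints_iff]
  rfl

theorem volume_semialgSet_prodConstraints :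
    volume (semialgSet (prodConstraints gS gB)) =
      volume (semialgSet gS) * volume (semialgSet gB) := by
  rw [semialgSet_prodConstraints_eq_preimage,
    (volume_measurePreserving_sumPiEquivProdPi
      (fun _ : Fin n ⊕ Fin m => ℝ)).measure_preimage_equiv, Measure.volume_eq_prod,
    Measure.prod_prod]

theorem integralFunctional_rename_inr (hS : IsCompact (semialgSet gS))
    (hB : IsCompact (semialgSet gB)) (q : MvPolynomial (Fin m) ℝ) :
    integralFunctional (isCompact_semialgSet_prodConstraints hS hB) (rename Sum.inr q) =
      volume.real (semialgSet gS) * integralFunctional hB q := by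
  have hpres := volume_measurePreserving_sumPiEquivProdPi (fun _ : Fin n ⊕ Fin m => ℝ)
  have h1 := hpres.setIntegral_preimage_emb (MeasurableEquiv.measurableEmbedding _)
    (fun p => (1 : ℝ) * eval p.2 q) (semialgSet gS ×ˢ semialgSet gB)
  rw [← semialgSet_prodConstraints_eq_preimage, Measure.volume_eq_prod,
    setIntegral_prod_mul (fun _ => (1 : ℝ)) (fun y => eval y q)] at h1
  simp only [one_mul, setIntegral_const, smul_eq_mul, mul_one] at h1
  simp only [integralFunctional, LinearMap.coe_mk, AddHom.coe_mk, eval_rename]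
  exact h1

theorem exists_isPrimalOptimal (hballS : HasBallConstraint gS) (hballB : HasBallConstraint gB)
    (hint : (interior (semialgSet gS)).Nonempty) {r : ℕ} (hr : rMin gS gB f ≤ r) :
    ∃ q, IsPrimalOptimal gS gB f r q := by
  have hS := isCompact_semialgSet hballS
  have hB := isCompact_semialgSet hballB
  have hzero := zero_mem_primalFeasible hballB hr
  -- Strict positivity over $S\times B$ fails in this case, but then every feasible point is
  -- optimal.
  by_cases hvol : volume (semialgSet gB) = 0
  · have hobj : ∀ q, primalObjective gB q = 0 := fun q => by
      rw [primalObjective_eq hB]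
      exact setIntegral_measure_zero _ hvol
    exact ⟨0, hzero, fun q _ => by simp [hobj]⟩
  have hvolS : volume (semialgSet gS) ≠ 0 :=
    (Measure.measure_pos_of_nonempty_interior volume hint).ne'
  have hvolS' : 0 < volume.real (semialgSet gS) :=
    ENNReal.toReal_pos hvolS hS.measure_lt_top.ne
  set l := integralFunctional (isCompact_semialgSet_prodConstraints hS hB) with hl
  have hvol' : volume (semialgSet (prodConstraints gS gB)) ≠ 0 := by
    rw [volume_semialgSet_prodConstraints]
    exact mul_ne_zero hvolS hvol
  -- The kernel of `T` consists of the polynomials in `y` alone, those unchanged by setting $x=0$.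
  -- On it, integration over $S\times B$ is the objective times $\mathrm{vol}(S)$.
  let T : MvPolynomial (Fin n ⊕ Fin m) ℝ →ₗ[ℝ] MvPolynomial (Fin n ⊕ Fin m) ℝ :=
    ((rename Sum.inr).comp (substLeft 0)).toLinearMap - LinearMap.id
  have hT : ∀ q, T (rename Sum.inr q) = 0 := fun q => by
    simp [T, substLeft_rename]
  have hT' : ∀ F, T F = 0 → rename Sum.inr (substLeft 0 F) = F := fun F hF => by
    simpa [T, sub_eq_zero] using hF
  obtain ⟨F, hTF, hF, hmin⟩ := exists_isMinOn_truncQuadModule (g := prodConstraints gS gB)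
    (r := r) (l := l) (fun j hj p hp => by
      refine integralFunctional_pos _ hvol' (fun w hw => ?_) (mul_ne_zero hj (pow_ne_zero 2 hp))
      rw [map_mul, map_pow]
      exact mul_nonneg (eval_withOne_nonneg hw j) (sq_nonneg _)) (hPoly f) T
    ⟨rename Sum.inr 0, hT 0, hzero.2⟩
  refine ⟨substLeft 0 F, ⟨?_, by rwa [hT' F hTF]⟩, fun q hq => ?_⟩
  -- The minimization imposes no degree bound; it follows from $q=(q-h_f)+h_f$.
  · rw [← totalDegree_rename_inr (n := n), hT' F hTF]
    have h1 := totalDegree_le_of_mem_truncQuadModule (halfDegree_le_of_rMin_le hr) hF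
    have h2 := (neg_hPoly_mem_sosCone hballB hr).2
    rw [totalDegree_neg] at h2
    have h3 := totalDegree_add (F - hPoly f) (hPoly f)
    rw [sub_add_cancel] at h3
    exact h3.trans (max_le h1 h2)
  · have h1 := hmin _ (hT q) hq.2
    rw [← hT' F hTF, hl, integralFunctional_rename_inr hS hB,
      integralFunctional_rename_inr hS hB] at h1
    change primalObjective gB _ ≤ primalObjective gB _
    rw [primalObjective_eq hB, primalObjective_eq hB]
    exact le_of_mul_le_mul_left h1 hvolS'

end PrimalAttainment

end

end PolyImage

namespace PolyImage

noncomputable section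

open MvPolynomial

variable {n m nS nB : ℕ} {gS : Fin nS → MvPolynomial (Fin n) ℝ}
  {gB : Fin nB → MvPolynomial (Fin m) ℝ} {f : Fin m → MvPolynomial (Fin n) ℝ}

/-! ### The function $h$ and the image $F$. -/

section Sup

theorem eval_hPoly (x : Fin n → ℝ) (y : Fin m → ℝ) :
    eval (Sum.elim x y) (hPoly f) = -∑ j, (y j - polyMap f x j) ^ 2 := by
  simp [hPoly, polyMap, eval_rename, Function.comp_def]

theorem eval_hPoly_nonpos (x : Fin n → ℝ) (y : Fin m → ℝ) :
    eval (Sum.elim x y) (hPoly f) ≤ 0 := by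
  rw [eval_hPoly, neg_nonpos]
  exact Finset.sum_nonneg fun j _ => sq_nonneg _

theorem le_hSup {S : Set (Fin n → ℝ)} {x : Fin n → ℝ} (hx : x ∈ S) (y : Fin m → ℝ) :
    eval (Sum.elim x y) (hPoly f) ≤ hSup S f y :=
  le_ciSup (f := fun x : S => eval (Sum.elim x.1 y) (hPoly f))
    ⟨0, by rintro _ ⟨x, rfl⟩; exact eval_hPoly_nonpos _ _⟩ ⟨x, hx⟩

theorem continuous_eval_sumElim (p : MvPolynomial (Fin n ⊕ Fin m) ℝ) :
    Continuous fun w : (Fin m → ℝ) × (Fin n → ℝ) => eval (Sum.elim w.2 w.1) p := by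
  refine (continuous_eval p).comp (continuous_pi fun i => ?_)
  rcases i with i | i <;> simp only [Sum.elim_inl, Sum.elim_inr] <;> fun_prop

theorem continuous_hSup {S : Set (Fin n → ℝ)} (hS : IsCompact S) :
    Continuous (hSup S f) := by
  have h1 : hSup S f =
      fun y => sSup ((fun x => eval (Sum.elim x y) (hPoly f)) '' S) := by
    funext y
    rw [sSup_image']
    rfl
  rw [h1]
  exact hS.continuous_sSup (f := fun y x => eval (Sum.elim x y) (hPoly f))
    (continuous_eval_sumElim (hPoly f))

/-- Compactness makes the supremum a maximum, and a maximum equal to $0$ would exhibit $y$ as some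
$f(x)$. -/
theorem hSup_neg_of_notMem {S : Set (Fin n → ℝ)} (hS : IsCompact S) (hne : S.Nonempty)
    {y : Fin m → ℝ} (hy : y ∉ polyMap f '' S) : hSup S f y < 0 := by
  have : Nonempty S := hne.to_subtype
  have hcont : Continuous fun x : Fin n → ℝ => eval (Sum.elim x y) (hPoly f) := by
    have h := (continuous_eval_sumElim (hPoly f)).comp (Continuous.prodMk_right y)
    exact h
  obtain ⟨x, hx, hmax⟩ := hS.exists_isMaxOn hne hcont.continuousOn
  have h1 : hSup S f y ≤ eval (Sum.elim x y) (hPoly f) := ciSup_le fun x' => hmax x'.2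
  refine h1.trans_lt ((eval_hPoly_nonpos x y).lt_of_ne fun h0 => hy ⟨x, hx, ?_⟩)
  rw [eval_hPoly, neg_eq_zero, Finset.sum_eq_zero_iff_of_nonneg fun j _ => sq_nonneg _] at h0
  funext j
  have := h0 j (Finset.mem_univ j)
  exact (sub_eq_zero.1 (pow_eq_zero_iff two_ne_zero |>.1 this)).symm

theorem hSup_le_eval_of_mem_primalFeasible (hS : (semialgSet gS).Nonempty) {r : ℕ}
    {q : MvPolynomial (Fin m) ℝ} (hq : q ∈ primalFeasible gS gB f r) {y : Fin m → ℝ}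
    (hy : y ∈ semialgSet gB) : hSup (semialgSet gS) f y ≤ eval y q := by
  have : Nonempty (semialgSet gS) := hS.to_subtype
  refine ciSup_le fun x => ?_
  have h1 := eval_nonneg_of_mem_truncQuadModule hq.2 (w := Sum.elim x.1 y)
    (mem_semialgSet_prodConstraints_iff.2 ⟨x.2, hy⟩)
  rw [map_sub, eval_rename, Sum.elim_comp_inr] at h1
  linarith

theorem image_subset_outerSet
    (hfB : polyMap f '' semialgSet gS ⊆ semialgSet gB) {r : ℕ}
    {q : MvPolynomial (Fin m) ℝ} (hq : q ∈ primalFeasible gS gB f r) :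
    polyMap f '' semialgSet gS ⊆ outerSet (semialgSet gB) q := by
  intro y hy
  refine ⟨hfB hy, ?_⟩
  have hyB := hfB hy
  obtain ⟨x, hx, rfl⟩ := hy
  have h1 := (le_hSup (f := f) hx (polyMap f x)).trans
    (hSup_le_eval_of_mem_primalFeasible ⟨x, hx⟩ hq hyB)
  rw [eval_hPoly] at h1
  simpa using h1

end Sup

/-! ### Convergence in $L^1$ and in volume. -/

section Convergence

/-- Polynomials are uniformly dense in the continuous functions on a compact set. -/
theorem exists_polynomial_near {σ : Type*} {K : Set (σ → ℝ)} (hK : IsCompact K)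
    {φ : (σ → ℝ) → ℝ} (hφ : Continuous φ) {ε : ℝ} (hε : 0 < ε) :
    ∃ q : MvPolynomial σ ℝ, ∀ x ∈ K, |eval x q - φ x| < ε := by
  let Θ : MvPolynomial σ ℝ →ₐ[ℝ] C(σ → ℝ, ℝ) := aeval fun i => ⟨fun x => x i, continuous_apply i⟩
  have hΘ : ∀ q x, Θ q x = eval x q := fun q x => by
    have : (ContinuousMap.evalAlgHom ℝ ℝ x).comp Θ = (aeval x : MvPolynomial σ ℝ →ₐ[ℝ] ℝ) := by
      refine algHom_ext fun i => ?_
      simp [Θ]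
    have := DFunLike.congr_fun this q
    simpa [aeval_eq_eval] using this
  have hsep : Θ.range.SeparatesPoints := by
    intro x y hxy
    obtain ⟨i, hi⟩ := Function.ne_iff.1 hxy
    refine ⟨_, ⟨Θ (X i), ⟨X i, rfl⟩, rfl⟩, ?_⟩
    simpa [hΘ] using hi
  obtain ⟨_, ⟨q, rfl⟩, hq⟩ :=
    ContinuousMap.exists_mem_subalgebra_near_continuous_of_isCompact_of_separatesPoints hsep
      ⟨φ, hφ⟩ hK hε
  refine ⟨q, fun x hx => ?_⟩
  rw [← hΘ]
  exact hq x hx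

/-- Ensures that the integrals of $|q_r-h|$ are genuine, not the default value $0$ of a
non-integrable function. -/
theorem integrableOn_hSup (hS : IsCompact (semialgSet gS)) (hB : IsCompact (semialgSet gB)) :
    IntegrableOn (hSup (semialgSet gS) f) (semialgSet gB) :=
  (continuous_hSup hS).continuousOn.integrableOn_compact hB

/-- A polynomial within $\varepsilon/2$ of $h+\varepsilon/2$ on $B$ lies strictly between $h$ and
$h+\varepsilon$; so $q-h_f>0$ on $S\times B$, and Putinar's theorem gives feasibility for all large
$r$. -/
theorem exists_primalFeasible_near (hS : (semialgSet gS).Nonempty)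
    (hfB : polyMap f '' semialgSet gS ⊆ semialgSet gB)
    (hballS : HasBallConstraint gS) (hballB : HasBallConstraint gB) {ε : ℝ} (hε : 0 < ε) :
    ∃ r₀, ∀ r, r₀ ≤ r → ∃ q ∈ primalFeasible gS gB f r,
      primalObjective gB q ≤ ∫ y in semialgSet gB, (hSup (semialgSet gS) f y + ε) := by
  have hSc := isCompact_semialgSet hballS
  have hB := isCompact_semialgSet hballB
  have hcont := continuous_hSup (f := f) hSc
  obtain ⟨q, hq⟩ := exists_polynomial_near hB
    (φ := fun y => hSup (semialgSet gS) f y + ε / 2) (by fun_prop) (half_pos hε)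
  obtain ⟨r₀, hr₀⟩ := eventually_mem_truncQuadModule (g := prodConstraints gS gB)
    (fun r _ => exists_sq_mul_ball_mem hballS hballB r)
    (by
      obtain ⟨x, hx⟩ := hS
      exact ⟨Sum.elim x (polyMap f x),
        mem_semialgSet_prodConstraints_iff.2 ⟨hx, hfB ⟨x, hx, rfl⟩⟩⟩)
    (p := rename Sum.inr q - hPoly f)
    (fun w hw => by
      obtain ⟨hw₁, hw₂⟩ := mem_semialgSet_prodConstraints_iff.1 hw
      have h1 := (abs_lt.1 (hq _ hw₂)).1
      have h2 := le_hSup (f := f) hw₁ (w ∘ Sum.inr)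
      rw [Sum.elim_comp_inl_inr] at h2
      rw [map_sub, eval_rename]
      linarith)
  refine ⟨max r₀ q.totalDegree, fun r hr => ⟨q, ⟨?_, hr₀ r ((le_max_left _ _).trans hr)⟩, ?_⟩⟩
  · have := (le_max_right r₀ q.totalDegree).trans hr
    omega
  · rw [primalObjective_eq hB]
    refine setIntegral_mono_on (integrableOn_eval hB q)
      ((hcont.add continuous_const).continuousOn.integrableOn_compact hB) hB.measurableSet
      fun y hy => ?_
    have := (abs_lt.1 (hq y hy)).2
    linarith

theorem tendsto_integral_abs_sub_hSup (hS : (semialgSet gS).Nonempty)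
    (hfB : polyMap f '' semialgSet gS ⊆ semialgSet gB)
    (hballS : HasBallConstraint gS) (hballB : HasBallConstraint gB)
    {q : ℕ → MvPolynomial (Fin m) ℝ}
    (hq : ∀ r, rMin gS gB f ≤ r → IsPrimalOptimal gS gB f r (q r)) :
    Tendsto (fun r => ∫ y in semialgSet gB, |eval y (q r) - hSup (semialgSet gS) f y|)
      atTop (𝓝 0) := by
  have hSc := isCompact_semialgSet hballS
  have hB := isCompact_semialgSet hballB
  have hint := integrableOn_hSup (f := f) hSc hB
  rw [Metric.tendsto_atTop]
  intro ε hε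
  set V := volume.real (semialgSet gB) with hV
  have hV0 : 0 ≤ V := measureReal_nonneg
  -- Dividing by $V+1$ rather than $V$ covers $V=0$ and leaves the final bound strict.
  obtain ⟨r₀, hr₀⟩ := exists_primalFeasible_near hS hfB hballS hballB
    (ε := ε / (V + 1)) (by positivity)
  refine ⟨max r₀ (rMin gS gB f), fun r hr => ?_⟩
  have hopt := hq r ((le_max_right _ _).trans hr)
  obtain ⟨p, hp, hpobj⟩ := hr₀ r ((le_max_left _ _).trans hr)
  have h1 : primalObjective gB (q r) ≤ primalObjective gB p := hopt.2 hp
  have h2 : ∫ y in semialgSet gB, |eval y (q r) - hSup (semialgSet gS) f y| =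
      primalObjective gB (q r) - ∫ y in semialgSet gB, hSup (semialgSet gS) f y := by
    rw [primalObjective_eq hB]
    refine Eq.trans (setIntegral_congr_fun hB.measurableSet fun y hy => ?_)
      (integral_sub (integrableOn_eval hB (q r)) hint)
    exact abs_of_nonneg (sub_nonneg.2 (hSup_le_eval_of_mem_primalFeasible hS hopt.1 hy))
  have h3 : ∫ y in semialgSet gB, (hSup (semialgSet gS) f y + ε / (V + 1)) =
      (∫ y in semialgSet gB, hSup (semialgSet gS) f y) + V * (ε / (V + 1)) := by
    rw [integral_add hint (integrableOn_const hB.measure_lt_top.ne)]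
    simp [hV]
  have h4 : V * (ε / (V + 1)) < ε := by
    rw [mul_div_assoc', div_lt_iff₀ (by linarith)]
    nlinarith
  have h5 : 0 ≤ ∫ y in semialgSet gB, |eval y (q r) - hSup (semialgSet gS) f y| :=
    integral_nonneg fun y => abs_nonneg _
  rw [Real.dist_eq, sub_zero, abs_of_nonneg h5, h2]
  linarith

/-- If `u r → φ` in `L¹(B)`, then the part of the superlevel sets `{u r ≥ 0}` on which
`φ < 0` has vanishing measure. -/
theorem tendsto_volume_superlevel {B : Set (Fin m → ℝ)} (hB : IsCompact B)
    {φ : (Fin m → ℝ) → ℝ} (hφ : Continuous φ) {u : ℕ → (Fin m → ℝ) → ℝ}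
    (hu : ∀ r, Continuous (u r))
    (hlim : Tendsto (fun r => ∫ y in B, |u r y - φ y|) atTop (𝓝 0)) :
    Tendsto (fun r => volume {y ∈ B | 0 ≤ u r y ∧ φ y < 0}) atTop (𝓝 0) := by
  -- Points where `φ` is only slightly negative escape Markov's inequality, but these slabs decrease
  -- to the empty set inside a set of finite measure.
  have hslab : Tendsto (fun k : ℕ => volume {y ∈ B | -(1 / ((k : ℝ) + 1)) < φ y ∧ φ y < 0})
      atTop (𝓝 0) := by
    have hempty : ⋂ k : ℕ, {y ∈ B | -(1 / ((k : ℝ) + 1)) < φ y ∧ φ y < 0} = ∅ := by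
      refine Set.eq_empty_of_forall_notMem fun y hy => ?_
      have hy' := fun k : ℕ => (Set.mem_iInter.1 hy k).2
      obtain ⟨k, hk⟩ := exists_nat_one_div_lt (neg_pos.2 (hy' 0).2)
      have := (hy' k).1
      linarith
    rw [← measure_empty (μ := (volume : Measure (Fin m → ℝ))), ← hempty]
    refine tendsto_measure_iInter_atTop (fun k => ?_) (fun k l hkl y hy => ?_) ⟨0, ?_⟩
    · exact (hB.measurableSet.inter ((measurableSet_lt measurable_const hφ.measurable).inter
        (measurableSet_lt hφ.measurable measurable_const))).nullMeasurableSet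
    · refine ⟨hy.1, lt_of_le_of_lt ?_ hy.2.1, hy.2.2⟩
      exact neg_le_neg (Nat.one_div_le_one_div hkl)
    · exact ((measure_mono fun y hy => hy.1).trans_lt hB.measure_lt_top).ne
  rw [ENNReal.tendsto_nhds_zero]
  intro ε hε
  rcases eq_or_ne ε ⊤ with rfl | hεtop
  · exact Eventually.of_forall fun _ => le_top
  obtain ⟨k, hk⟩ := ((ENNReal.tendsto_nhds_zero.1 hslab) (ε / 2) (ENNReal.half_pos hε.ne')).exists
  set δ : ℝ := 1 / ((k : ℝ) + 1) with hδ
  have hδ0 : 0 < δ := Nat.one_div_pos_of_nat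
  have hε2 : 0 < (ε / 2).toReal :=
    ENNReal.toReal_pos (ENNReal.half_pos hε.ne').ne' (ENNReal.div_ne_top hεtop two_ne_zero)
  have hev := hlim.eventually (gt_mem_nhds (mul_pos hδ0 hε2))
  filter_upwards [hev] with r hr
  have hcont : Continuous fun y => |u r y - φ y| := ((hu r).sub hφ).abs
  -- Off the slab $\varphi\le-\delta$, so $u_r\ge0$ forces $|u_r-\varphi|\ge\delta$; Markov bounds
  -- the measure of that set.
  have hmarkov := mul_meas_ge_le_integral_of_nonneg (μ := volume.restrict B)
    (ae_of_all _ fun y => abs_nonneg (u r y - φ y)) (hcont.continuousOn.integrableOn_compact hB) δ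
  have hmeas : MeasurableSet {y | δ ≤ |u r y - φ y|} :=
    measurableSet_le measurable_const hcont.measurable
  have hfar : volume {y ∈ B | δ ≤ |u r y - φ y|} ≤ ε / 2 := by
    have h1 : {y ∈ B | δ ≤ |u r y - φ y|} = {y | δ ≤ |u r y - φ y|} ∩ B := by
      ext y
      exact and_comm
    have h2 : (volume.restrict B).real {y | δ ≤ |u r y - φ y|} < (ε / 2).toReal :=
      lt_of_mul_lt_mul_left (hmarkov.trans_lt hr) hδ0.le
    rw [h1, ← Measure.restrict_apply hmeas]
    have hfin : (volume.restrict B) {y | δ ≤ |u r y - φ y|} ≠ ⊤ :=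
      ((measure_mono (Set.subset_univ _)).trans_lt (by
        rw [Measure.restrict_apply_univ]; exact hB.measure_lt_top)).ne
    exact (ENNReal.toReal_le_toReal hfin (ENNReal.div_ne_top hεtop two_ne_zero)).1 h2.le
  calc volume {y ∈ B | 0 ≤ u r y ∧ φ y < 0}
      ≤ volume ({y ∈ B | -δ < φ y ∧ φ y < 0} ∪ {y ∈ B | δ ≤ |u r y - φ y|}) := by
        refine measure_mono fun y hy => ?_
        obtain ⟨hyB, hy₁, hy₂⟩ := hy
        rcases lt_or_ge (-δ) (φ y) with h | h
        · exact Or.inl ⟨hyB, h, hy₂⟩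
        · exact Or.inr ⟨hyB, le_trans (by linarith) (le_abs_self _)⟩
    _ ≤ ε / 2 + ε / 2 := (measure_union_le _ _).trans (add_le_add hk hfar)
    _ = ε := ENNReal.add_halves ε

theorem tendsto_volume_outerSet_diff (hS : (semialgSet gS).Nonempty)
    (hballS : HasBallConstraint gS) (hballB : HasBallConstraint gB)
    {q : ℕ → MvPolynomial (Fin m) ℝ}
    (hlim : Tendsto (fun r => ∫ y in semialgSet gB, |eval y (q r) - hSup (semialgSet gS) f y|)
      atTop (𝓝 0)) :
    Tendsto (fun r => volume (outerSet (semialgSet gB) (q r) \ (polyMap f '' semialgSet gS)))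
      atTop (𝓝 0) := by
  have hSc := isCompact_semialgSet hballS
  have h := tendsto_volume_superlevel (isCompact_semialgSet hballB) (continuous_hSup (f := f) hSc)
    (fun r => continuous_eval (q r)) hlim
  refine tendsto_of_tendsto_of_tendsto_of_le_of_le tendsto_const_nhds h (fun _ => zero_le)
    fun r => measure_mono ?_
  rintro y ⟨⟨hyB, hyq⟩, hyF⟩
  exact ⟨hyB, hyq, hSup_neg_of_notMem hSc hS hyF⟩

end Convergence

end

end PolyImage

theorem mainTheorem1 {n m nS nB : ℕ}
    (gS : Fin nS → MvPolynomial (Fin n) ℝ) (gB : Fin nB → MvPolynomial (Fin m) ℝ)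
    (f : Fin m → MvPolynomial (Fin n) ℝ)
    (hS : (PolyImage.semialgSet gS).Nonempty)
    (hfB : PolyImage.polyMap f '' PolyImage.semialgSet gS ⊆ PolyImage.semialgSet gB)
    (hballS : PolyImage.HasBallConstraint gS) (hballB : PolyImage.HasBallConstraint gB) :
    (∀ r, PolyImage.rMin gS gB f ≤ r →
      PolyImage.primalValue gS gB f r = PolyImage.dualValue gS gB f r ∧
      ∃ z, PolyImage.IsDualOptimal gS gB f r z) ∧
    ((interior (PolyImage.semialgSet gS)).Nonempty →
      (∀ r, PolyImage.rMin gS gB f ≤ r → ∃ q, PolyImage.IsPrimalOptimal gS gB f r q) ∧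
      IntegrableOn (PolyImage.hSup (PolyImage.semialgSet gS) f) (PolyImage.semialgSet gB) ∧
      ∀ q : ℕ → MvPolynomial (Fin m) ℝ,
        (∀ r, PolyImage.rMin gS gB f ≤ r → PolyImage.IsPrimalOptimal gS gB f r (q r)) →
        Tendsto (fun r => ∫ y in PolyImage.semialgSet gB,
          |MvPolynomial.eval y (q r) - PolyImage.hSup (PolyImage.semialgSet gS) f y|)
          atTop (𝓝 0) ∧
        (∀ r, PolyImage.rMin gS gB f ≤ r →
          PolyImage.polyMap f '' PolyImage.semialgSet gS ⊆
            PolyImage.outerSet (PolyImage.semialgSet gB) (q r)) ∧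
        Tendsto (fun r => volume (PolyImage.outerSet (PolyImage.semialgSet gB) (q r) \
          (PolyImage.polyMap f '' PolyImage.semialgSet gS))) atTop (𝓝 0)) := by
  refine ⟨fun r hr => PolyImage.primalValue_eq_dualValue hS hballS hballB hr, fun hint =>
    ⟨fun r hr => PolyImage.exists_isPrimalOptimal hballS hballB hint hr,
      PolyImage.integrableOn_hSup (PolyImage.isCompact_semialgSet hballS)
        (PolyImage.isCompact_semialgSet hballB), fun q hq => ?_⟩⟩
  have hlim := PolyImage.tendsto_integral_abs_sub_hSup hS hfB hballS hballB hq
  exact ⟨hlim, fun r hr => PolyImage.image_subset_outerSet hfB (hq r hr).1,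
    PolyImage.tendsto_volume_outerSet_diff hS hballS hballB hlim⟩
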